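/- Let $M$ be a smooth manifold and let $A$, $E$ be smooth real vector bundles over $M$. Let $B\subset\mathrm{Hom}(A,E)$ be a subbundle for which the pairing $\langle a,b\rangle_E=b(a)$, $A\times_M B\to E$, is nondegenerate in both arguments on every fibre; equivalently, $B$ is a vector bundle with a smooth fibrewise nondegenerate pairing $A\times_M B\to E$. Then also $A\subset\mathrm{Hom}(B,E)$. Put $\mathrm{Hom}(\wedge^0A,E)_B=E$ and, for $k\ge1$, let $\mathrm{Hom}(\wedge^kA,E)_B$ consist of the $\mu\in\mathrm{Hom}(\wedge^kA,E)$ with $\mu(X_1,\dots,X_{k-1},\cdot)\in B$ for all $X_i$; define $\mathrm{Hom}(\wedge^kB,E)_A$ in the same way. Let $(A,[\cdot,\cdot],a)$ be a Lie algebroid with a representation $\rho_A$ on $E$ (a bundle map from $A$ to the bundle $\mathfrak D E$ of covariant differential operators of $E$, compatible with anchors and brackets), and let $\mathrm d^A$ be its coboundary operator. Assume that $\rho_A$ is $B$-invariant, i.e. that the $\Gamma(\mathrm{Hom}(\wedge^kA,E)_B)$, $k\ge0$, form a subcomplex for $\mathrm d^A$. For $X\in\Gamma(A)$, $\xi\in\Gamma(B)$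 let $L_X\xi\in\Gamma(B)$ be given by $(L_X\xi)(Y)=\rho_A(X)\langle Y,\xi\rangle_E-\langle[X,Y],\xi\rangle_E$, and for $\Xi\in\Gamma(\mathrm{Hom}(\wedge^kB,E)_A)$ put $$(L_X\Xi)(\xi_1,\dots,\xi_k)=\rho_A(X)\,\Xi(\xi_1,\dots,\xi_k)-\sum_i\Xi(\xi_1,\dots,L_X\xi_i,\dots,\xi_k).$$ Let $\Lambda\in\Gamma(\mathrm{Hom}(\wedge^2B,E)_A)$, let $\Lambda_\natural:B\to A$ be given by $\langle\Lambda_\natural\xi,\eta\rangle_E=\Lambda(\xi,\eta)$, and define $[\Lambda,\Lambda]\in\Gamma(\mathrm{Hom}(\wedge^3B,E)_A)$ and $[\Lambda,\Lambda]_\natural:\wedge^2B\to A$ by $$[\Lambda,\Lambda](\xi_1,\xi_2,\xi_3)=2\langle \Lambda_\natural\xi_3,L_{\Lambda_\natural\xi_1}\xi_2\rangle_E+\text{c.p.},\qquad \langle[\Lambda,\Lambda]_\natural(\xi,\eta),\zeta\rangle_E=[\Lambda,\Lambda](\xi,\eta,\zeta).$$ Assume that (1) $\rho_A\circ[\Lambda,\Lambda]_\natural=0$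 and (2) $L_X[\Lambda,\Lambda]=0$ for all $X\in\Gamma(A)$. Then $B$, with the bracket $[\xi,\eta]_\Lambda=L_{\Lambda_\natural\xi}\eta-L_{\Lambda_\natural\eta}\xi-\mathrm d^A(\Lambda(\xi,\eta))$ and the anchor $a_B=a\circ\Lambda_\natural$, is a Lie algebroid; $\rho_B=\rho_A\circ\Lambda_\natural$ is a representation of it on $E$, and it is $A$-invariant (the $\Gamma(\mathrm{Hom}(\wedge^kB,E)_A)$ form a subcomplex for its coboundary operator $\mathrm d^B$). Moreover $((A,\rho_A);(B,\rho_B))$ is an $E$-Lie bialgebroid: for all $X,Y\in\Gamma(A)$ and $u\in\Gamma(E)$, $$\mathrm d^B[X,Y]=L_X(\mathrm d^BY)-L_Y(\mathrm d^BX),\qquad L_{\mathrm d^Au}X=-L_{\mathrm d^Bu}X,\qquad \langle\mathrm d^Bu,\mathrm d^Au\rangle_E=0,$$ where $L_\xi X\in\Gamma(A)$, for $\xi\in\Gamma(B)$, is given by $\langle L_\xi X,\eta\rangle_E=\rho_B(\xi)\langle X,\eta\rangle_E-\langle X,[\xi,\eta]_\Lambda\rangle_E$, and $L_{\mathrm d^Bu}X=[\mathrm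 d^Bu,X]$. -/

import Mathlib

open Bundle Manifold
open scoped ContDiff

noncomputable section

namespace ELie

universe uM uH uEM uFA uA uFB uB uFE uE

variable {EM : Type uEM} [NormedAddCommGroup EM] [NormedSpace ℝ EM]
  {H : Type uH} [TopologicalSpace H] {I : ModelWithCorners ℝ EM H}
  {M : Type uM} [TopologicalSpace M] [ChartedSpace H M]

/-! ### Sections as a module over the smooth functions -/

section SectionModule

variable {F : Type uA} [NormedAddCommGroup F] [NormedSpace ℝ F]
  {V : M → Type uB} [TopologicalSpace (TotalSpace F V)] [∀ x, AddCommGroup (V x)]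
  [∀ x, Module ℝ (V x)] [∀ x, TopologicalSpace (V x)] [FiberBundle F V] [VectorBundle ℝ F V]

instance instSMulSection : SMul C^∞⟮I, M; ℝ⟯ Cₛ^∞⟮I; F, V⟯ where
  smul f s := ⟨fun x => f x • s x, f.contMDiff.smul_section s.contMDiff⟩

@[simp]
theorem smul_section_apply (f : C^∞⟮I, M; ℝ⟯) (s : Cₛ^∞⟮I; F, V⟯) (x : M) :
    (f • s) x = f x • s x := rfl

instance instModuleSection : Module C^∞⟮I, M; ℝ⟯ Cₛ^∞⟮I; F, V⟯ where
  one_smul s := by ext x; exact one_smul ℝ (s x)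
  mul_smul f g s := by ext x; exact mul_smul (f x) (g x) (s x)
  smul_zero f := by ext x; exact smul_zero (f x)
  smul_add f s t := by ext x; exact smul_add (f x) (s x) (t x)
  add_smul f g s := by ext x; exact add_smul (f x) (g x) (s x)
  zero_smul s := by ext x; exact zero_smul ℝ (s x)

end SectionModule

variable {FA : Type uFA} [NormedAddCommGroup FA] [NormedSpace ℝ FA]
  {A : M → Type uA} [TopologicalSpace (TotalSpace FA A)] [∀ x, AddCommGroup (A x)]
  [∀ x, Module ℝ (A x)] [∀ x, TopologicalSpace (A x)] [FiberBundle FA A] [VectorBundle ℝ FA A]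
  {FB : Type uFB} [NormedAddCommGroup FB] [NormedSpace ℝ FB]
  {B : M → Type uB} [TopologicalSpace (TotalSpace FB B)] [∀ x, AddCommGroup (B x)]
  [∀ x, Module ℝ (B x)] [∀ x, TopologicalSpace (B x)] [FiberBundle FB B] [VectorBundle ℝ FB B]
  {FE : Type uFE} [NormedAddCommGroup FE] [NormedSpace ℝ FE]
  {E : M → Type uE} [TopologicalSpace (TotalSpace FE E)] [∀ x, AddCommGroup (E x)]
  [∀ x, Module ℝ (E x)] [∀ x, TopologicalSpace (E x)] [FiberBundle FE E] [VectorBundle ℝ FE E]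

/-! ### Lie algebroids and representations

Vector bundle maps over the identity of `M` are given by the `C^∞(M)`-linear maps they induce on
smooth sections, and smooth `E`-valued `k`-forms by the `C^∞(M)`-multilinear alternating maps they
induce on smooth sections. -/

variable (I FA A) in
/-- A Lie algebroid structure on the vector bundle `A → M`: an `ℝ`-Lie bracket on `Γ(A)` and an
anchor `A → TM` preserving brackets, such that `[X, fY] = f[X, Y] + (a(X)f)Y`. -/
structure LieAlgebroid [IsManifold I ∞ M] where
  /-- the bracket on sections -/
  bracket : Cₛ^∞⟮I; FA, A⟯ →ₗ[ℝ] Cₛ^∞⟮I; FA, A⟯ →ₗ[ℝ] Cₛ^∞⟮I; FA, A⟯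
  bracket_self : ∀ X, bracket X X = 0
  jacobi : ∀ X Y Z, bracket (bracket X Y) Z + bracket (bracket Y Z) X
    + bracket (bracket Z X) Y = 0
  /-- the anchor -/
  anchor : Cₛ^∞⟮I; FA, A⟯ →ₗ[C^∞⟮I, M; ℝ⟯] Cₛ^∞⟮I; EM, (TangentSpace I : M → Type uEM)⟯
  anchor_bracket : ∀ X Y x,
    anchor (bracket X Y) x = VectorField.mlieBracket I (anchor X) (anchor Y) x
  leibniz : ∀ (f : C^∞⟮I, M; ℝ⟯) (X Y : Cₛ^∞⟮I; FA, A⟯) (x : M),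
    bracket X (f • Y) x = f x • bracket X Y x + (mvfderiv I f x (anchor X x)) • Y x

variable (FE E) in
/-- A representation of the Lie algebroid `A` on `E`: a bundle map from `A` to the bundle `𝔇E` of
covariant differential operators of `E` that is compatible with the anchors and preserves brackets.
The section `op X` of `𝔇E` is the differential operator `u ↦ op X u` with symbol `a(X)`. -/
structure Representation [IsManifold I ∞ M] (L : LieAlgebroid I FA A) where
  /-- the differential operator attached to a section of `A` -/
  op : Cₛ^∞⟮I; FA, A⟯ →ₗ[ℝ] Cₛ^∞⟮I; FE, E⟯ →ₗ[ℝ] Cₛ^∞⟮I; FE, E⟯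
  smul_op : ∀ (f : C^∞⟮I, M; ℝ⟯) X u, op (f • X) u = f • op X u
  leibniz : ∀ (f : C^∞⟮I, M; ℝ⟯) (X : Cₛ^∞⟮I; FA, A⟯) (u : Cₛ^∞⟮I; FE, E⟯) (x : M),
    op X (f • u) x = f x • op X u x + (mvfderiv I f x (L.anchor X x)) • u x
  flat : ∀ X Y u, op (L.bracket X Y) u = op X (op Y u) - op Y (op X u)

variable (I FA A FE E) in
/-- The sections of `Hom(∧^k A, E)`. -/
abbrev Form (k : ℕ) :=
  Cₛ^∞⟮I; FA, A⟯ [⋀^Fin k]→ₗ[C^∞⟮I, M; ℝ⟯] Cₛ^∞⟮I; FE, E⟯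

/-- The coboundary operator `d^A` of a representation of `A` on `E`, evaluated on sections. In the
second sum, the pair `(i, j)` runs over the positions `i < j`, both of which are removed. -/
def coboundary [IsManifold I ∞ M] {L : LieAlgebroid I FA A} (ρ : Representation FE E L) :
    (k : ℕ) → Form I FA A FE E k → (Fin (k + 1) → Cₛ^∞⟮I; FA, A⟯) → Cₛ^∞⟮I; FE, E⟯
  | 0, μ, X => ρ.op (X 0) (μ ![])
  | k + 1, μ, X =>
    ∑ i : Fin (k + 2), (-1 : ℝ) ^ (i : ℕ) • ρ.op (X i) (μ (i.removeNth X))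
      + ∑ j : Fin (k + 2), ∑ i : Fin (k + 1),
        if i.castSucc < j then
          (-1 : ℝ) ^ ((i : ℕ) + (j : ℕ)) •
            μ (Fin.cons (L.bracket (X i.castSucc) (X j)) (i.removeNth (j.removeNth X)))
        else 0

/-! ### `E`-dual pairs of vector bundles -/

variable (I FA A FB B FE E) in
/-- An `E`-dual pair `(A, B)` of vector bundles: a smooth `E`-valued pairing of `A` and `B` that is
nondegenerate on every fibre. It identifies `B` with a subbundle of `Hom(A, E)`, by
`b ↦ (a ↦ ⟨a, b⟩)`, and `A` with a subbundle of `Hom(B, E)`. -/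
structure DualPair where
  /-- the pairing on the fibres -/
  pair : ∀ x : M, A x →ₗ[ℝ] B x →ₗ[ℝ] E x
  smooth : ∀ (X : Cₛ^∞⟮I; FA, A⟯) (ξ : Cₛ^∞⟮I; FB, B⟯),
    CMDiff ∞ (T% (fun x => pair x (X x) (ξ x)))
  nondeg_left : ∀ x (a : A x), (∀ b : B x, pair x a b = 0) → a = 0
  nondeg_right : ∀ x (b : B x), (∀ a : A x, pair x a b = 0) → b = 0

namespace DualPair

/-- The same pair with the roles of `A` and `B` exchanged. -/
def swap (P : DualPair I FA A FB B FE E) : DualPair I FB B FA A FE E where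
  pair x := (P.pair x).flip
  smooth ξ X := P.smooth X ξ
  nondeg_left := P.nondeg_right
  nondeg_right := P.nondeg_left

/-- The pairing `⟨X, ξ⟩` of sections. -/
def pairing (P : DualPair I FA A FB B FE E) :
    Cₛ^∞⟮I; FA, A⟯ →ₗ[C^∞⟮I, M; ℝ⟯] Cₛ^∞⟮I; FB, B⟯ →ₗ[C^∞⟮I, M; ℝ⟯] Cₛ^∞⟮I; FE, E⟯ :=
  LinearMap.mk₂ _ (fun X ξ => ⟨fun x => P.pair x (X x) (ξ x), P.smooth X ξ⟩)
    (fun X Y ξ => by ext x; exact LinearMap.map_add₂ (P.pair x) (X x) (Y x) (ξ x))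
    (fun f X ξ => by ext x; exact LinearMap.map_smul₂ (P.pair x) (f x) (X x) (ξ x))
    (fun X ξ η => by ext x; exact (P.pair x (X x)).map_add (ξ x) (η x))
    (fun f X ξ => by ext x; exact (P.pair x (X x)).map_smul (f x) (ξ x))

@[simp]
theorem pairing_apply (P : DualPair I FA A FB B FE E) (X : Cₛ^∞⟮I; FA, A⟯)
    (ξ : Cₛ^∞⟮I; FB, B⟯) (x : M) : P.pairing X ξ x = P.pair x (X x) (ξ x) := rfl

/-- A section `ξ` of `B`, as an `E`-valued 1-form on `A`. -/
def toForm (P : DualPair I FA A FB B FE E) (ξ : Cₛ^∞⟮I; FB, B⟯) : Form I FA A FE E 1 :=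
  AlternatingMap.ofSubsingleton _ _ _ (0 : Fin 1) (P.pairing.flip ξ)

open Classical in
/-- If the map `φ : Γ(A) → Γ(E)` is `X ↦ ⟨X, ξ⟩` for a section `ξ` of `B`, then this `ξ`; it is
unique, as the pairing is nondegenerate and the fibres of `A` are spanned by smooth sections. If there
is no such `ξ`, the value is `0`; this does not occur below, by the invariance of representations. -/
def repr (P : DualPair I FA A FB B FE E) (φ : Cₛ^∞⟮I; FA, A⟯ → Cₛ^∞⟮I; FE, E⟯) :
    Cₛ^∞⟮I; FB, B⟯ :=
  if h : ∃ ξ, ∀ X, P.pairing X ξ = φ X then h.choose else 0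

theorem pairing_repr (P : DualPair I FA A FB B FE E) {φ : Cₛ^∞⟮I; FA, A⟯ → Cₛ^∞⟮I; FE, E⟯}
    (h : ∃ ξ, ∀ X, P.pairing X ξ = φ X) (X : Cₛ^∞⟮I; FA, A⟯) :
    P.pairing X (P.repr φ) = φ X := by
  rw [repr, dif_pos h]
  exact h.choose_spec X

/-- The form `μ` is a section of `Hom(∧^k A, E)_B`: no condition for `k = 0`; for `k ≥ 1`, the maps
`μ(X₁, …, X_{k-1}, ·)` are sections of `B ⊆ Hom(A, E)`. -/
def ValuedIn (P : DualPair I FA A FB B FE E) : (k : ℕ) → Form I FA A FE E k → Prop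
  | 0, _ => True
  | k + 1, μ => ∀ X : Fin k → Cₛ^∞⟮I; FA, A⟯, ∃ ξ : Cₛ^∞⟮I; FB, B⟯, ∀ Y : Cₛ^∞⟮I; FA, A⟯,
      μ (Fin.snoc (α := fun _ => Cₛ^∞⟮I; FA, A⟯) X Y) = P.pairing Y ξ

variable [IsManifold I ∞ M]

/-- The representation `ρ` of `A` is `B`-invariant: the sections of `Hom(∧^k A, E)_B`, `k ≥ 0`, form
a subcomplex for `d^A`. -/
def Invariant (P : DualPair I FA A FB B FE E) {L : LieAlgebroid I FA A}
    (ρ : Representation FE E L) : Prop :=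
  ∀ (k : ℕ) (μ : Form I FA A FE E k), P.ValuedIn k μ →
    ∃ ν : Form I FA A FE E (k + 1), P.ValuedIn (k + 1) ν ∧ ∀ X, ν X = coboundary ρ k μ X

/-- `d^A u` as a section of `B`, where `(d^A u)(X) = ρ(X)u`. -/
def dE (P : DualPair I FA A FB B FE E) {L : LieAlgebroid I FA A} (ρ : Representation FE E L)
    (u : Cₛ^∞⟮I; FE, E⟯) : Cₛ^∞⟮I; FB, B⟯ :=
  P.repr (fun X => ρ.op X u)

/-- The Lie derivative `L_X ξ` of a section `ξ` of `B`, as a section of `B`, where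
`(L_X ξ)(Y) = ρ(X)⟨Y, ξ⟩ - ⟨[X, Y], ξ⟩`. -/
def lie (P : DualPair I FA A FB B FE E) {L : LieAlgebroid I FA A} (ρ : Representation FE E L)
    (X : Cₛ^∞⟮I; FA, A⟯) (ξ : Cₛ^∞⟮I; FB, B⟯) : Cₛ^∞⟮I; FB, B⟯ :=
  P.repr (fun Y => ρ.op X (P.pairing Y ξ) - P.pairing (L.bracket X Y) ξ)

/-- For a `B`-invariant representation, `d^A u` is a section of `B`. -/
theorem Invariant.pairing_dE {P : DualPair I FA A FB B FE E} {L : LieAlgebroid I FA A}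
    {ρ : Representation FE E L} (h : P.Invariant ρ) (X : Cₛ^∞⟮I; FA, A⟯) (u : Cₛ^∞⟮I; FE, E⟯) :
    P.pairing X (P.dE ρ u) = ρ.op X u := by
  refine P.pairing_repr (φ := fun X => ρ.op X u) ?_ X
  obtain ⟨ν, h1, h2⟩ := h 0 (AlternatingMap.constOfIsEmpty _ _ _ u) trivial
  obtain ⟨ξ, hξ⟩ := h1 ![]
  refine ⟨ξ, fun Y => ?_⟩
  rw [← hξ Y, h2]
  rfl

/-- For a `B`-invariant representation, `L_X ξ` is a section of `B`. -/
theorem Invariant.pairing_lie {P : DualPair I FA A FB B FE E} {L : LieAlgebroid I FA A}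
    {ρ : Representation FE E L} (h : P.Invariant ρ) (X Y : Cₛ^∞⟮I; FA, A⟯)
    (ξ : Cₛ^∞⟮I; FB, B⟯) :
    P.pairing Y (P.lie ρ X ξ) = ρ.op X (P.pairing Y ξ) - P.pairing (L.bracket X Y) ξ := by
  refine P.pairing_repr
    (φ := fun Y => ρ.op X (P.pairing Y ξ) - P.pairing (L.bracket X Y) ξ) ?_ Y
  obtain ⟨ν, h1, h2⟩ := h 1 (P.toForm ξ) (fun _ => ⟨ξ, fun _ => rfl⟩)
  obtain ⟨η, hη⟩ := h1 ![X]
  refine ⟨η + P.dE ρ (P.pairing X ξ), fun Z => ?_⟩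
  have e : (Fin.snoc (α := fun _ => Cₛ^∞⟮I; FA, A⟯) ![X] Z) = ![X, Z] := by
    ext i : 1
    fin_cases i <;> rfl
  have e2 : coboundary ρ 1 (P.toForm ξ) ![X, Z] =
      ρ.op X (P.pairing Z ξ) - ρ.op Z (P.pairing X ξ) - P.pairing (L.bracket X Z) ξ := by
    simp [coboundary, toForm, Fin.sum_univ_two, Fin.removeNth, sub_eq_add_neg]
  rw [map_add, ← hη Z, h.pairing_dE, h2, e, e2]
  abel

/-- The Lie derivative `L_X Ξ` of a section `Ξ` of `Hom(∧^k B, E)_A`, evaluated on sections: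
`ρ(X)(Ξ(ξ₁, …, ξ_k)) - ∑ i, Ξ(ξ₁, …, L_X ξ_i, …, ξ_k)`. -/
def lieMulti (P : DualPair I FA A FB B FE E) {L : LieAlgebroid I FA A}
    (ρ : Representation FE E L) (X : Cₛ^∞⟮I; FA, A⟯) {k : ℕ}
    (Ξ : (Fin k → Cₛ^∞⟮I; FB, B⟯) → Cₛ^∞⟮I; FE, E⟯) (ξ : Fin k → Cₛ^∞⟮I; FB, B⟯) :
    Cₛ^∞⟮I; FE, E⟯ :=
  ρ.op X (Ξ ξ) - ∑ i, Ξ (Function.update ξ i (P.lie ρ X (ξ i)))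

/-- The bundle map `Λ_♮ : B → A` of a section `Λ` of `Hom(∧² B, E)_A`, where
`⟨Λ_♮ ξ, η⟩ = Λ(ξ, η)`. -/
def sharp (P : DualPair I FA A FB B FE E) (Λ : Form I FB B FE E 2) (ξ : Cₛ^∞⟮I; FB, B⟯) :
    Cₛ^∞⟮I; FA, A⟯ :=
  P.swap.repr (fun η => Λ ![ξ, η])

/-- The Schouten bracket `[K, N]` of sections of `Hom(∧² B, E)_A`:
`[K, N](ξ₁, ξ₂, ξ₃) = ⟨L_{Nξ₁}ξ₂, Kξ₃⟩ + ⟨L_{Kξ₁}ξ₂, Nξ₃⟩ + c.p.` -/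
def schouten (P : DualPair I FA A FB B FE E) {L : LieAlgebroid I FA A}
    (ρ : Representation FE E L) (K N : Form I FB B FE E 2) (ξ : Fin 3 → Cₛ^∞⟮I; FB, B⟯) :
    Cₛ^∞⟮I; FE, E⟯ :=
  let t (a b c : Cₛ^∞⟮I; FB, B⟯) : Cₛ^∞⟮I; FE, E⟯ :=
    P.pairing (P.sharp K c) (P.lie ρ (P.sharp N a) b)
      + P.pairing (P.sharp N c) (P.lie ρ (P.sharp K a) b)
  t (ξ 0) (ξ 1) (ξ 2) + t (ξ 1) (ξ 2) (ξ 0) + t (ξ 2) (ξ 0) (ξ 1)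

/-- The bundle map `[Λ, Λ]_♮ : ∧² B → A`, where `⟨[Λ, Λ]_♮(ξ, η), ζ⟩ = [Λ, Λ](ξ, η, ζ)`. -/
def schoutenSharp (P : DualPair I FA A FB B FE E) {L : LieAlgebroid I FA A}
    (ρ : Representation FE E L) (Λ : Form I FB B FE E 2) (ξ η : Cₛ^∞⟮I; FB, B⟯) :
    Cₛ^∞⟮I; FA, A⟯ :=
  P.swap.repr (fun ζ => P.schouten ρ Λ Λ ![ξ, η, ζ])

/-- The bracket `[ξ, η]_Λ = L_{Λξ}η - L_{Λη}ξ - d^A(Λ(ξ, η))` on the sections of `B`. -/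
def bracketOf (P : DualPair I FA A FB B FE E) {L : LieAlgebroid I FA A}
    (ρ : Representation FE E L) (Λ : Form I FB B FE E 2) (ξ η : Cₛ^∞⟮I; FB, B⟯) :
    Cₛ^∞⟮I; FB, B⟯ :=
  P.lie ρ (P.sharp Λ ξ) η - P.lie ρ (P.sharp Λ η) ξ - P.dE ρ (Λ ![ξ, η])

/-- `((A, ρA); (B, ρB))` is an `E`-dual pair of Lie algebroids and an `E`-Lie bialgebroid. -/
structure IsELieBialgebroid (P : DualPair I FA A FB B FE E)
    {LA : LieAlgebroid I FA A} (ρA : Representation FE E LA)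
    {LB : LieAlgebroid I FB B} (ρB : Representation FE E LB) : Prop where
  invariant_left : P.Invariant ρA
  invariant_right : P.swap.Invariant ρB
  /-- `d^B[X, Y] = L_X(d^B Y) - L_Y(d^B X)` -/
  d_bracket : ∀ (X Y : Cₛ^∞⟮I; FA, A⟯) (ξ : Fin 2 → Cₛ^∞⟮I; FB, B⟯),
    coboundary ρB 1 (P.swap.toForm (LA.bracket X Y)) ξ =
      P.lieMulti ρA X (coboundary ρB 1 (P.swap.toForm Y)) ξ
        - P.lieMulti ρA Y (coboundary ρB 1 (P.swap.toForm X)) ξ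
  /-- `L_{d^A u} X = - L_{d^B u} X` -/
  lie_d : ∀ (u : Cₛ^∞⟮I; FE, E⟯) (X : Cₛ^∞⟮I; FA, A⟯),
    P.swap.lie ρB (P.dE ρA u) X = - LA.bracket (P.swap.dE ρB u) X
  /-- `⟨d^B u, d^A u⟩ = 0` -/
  pairing_d : ∀ u : Cₛ^∞⟮I; FE, E⟯, P.pairing (P.swap.dE ρB u) (P.dE ρA u) = 0

end DualPair

end ELie

end

/-! Every identity between sections is tested against the pairing: it is nondegenerate on fibres,
and every fibre vector extends to a smooth section. Expanding the definitions leaves only `ρ_A`, the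
bracket of `A` and pairings.

The central object is the defect `N(ξ, η) = [Λξ, Ηη] - Λ[ξ, η]_Λ` with `Η = Λ`. Its pairing with `ζ`
is half of `[Λ, Λ](ξ, η, ζ)` (`pairing_sharpDefect`), so (1) says `ρ_A(N) = 0`. Taking symbols, the
anchor kills `N` too. Hence `ρ_A ∘ Λ` is flat and `a ∘ Λ` preserves brackets, although `Λ` itself
need not.

In the Jacobi sum, paired with `Y`, the flatness of `ρ_A` and the Jacobi identity of `A` cancel
everything except the terms in `[Λ, Λ]`, and these add up to half of `L_Y[Λ, Λ]`, which is zero by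
(2) (`bracketOf_jacobi`).

Cartan's formula `i_X d = L_X - d i_X` makes the coboundary recursive. By induction, `dμ` is a form,
and invariance in all degrees follows from the two cases `d u` and `L_X ξ`. For `B` these are
explicit: `d^B u = -Λ d^A u` and `L_ξ X = [Λξ, X] + Λ L_X ξ - Λ d^A⟨X, ξ⟩`.

The bialgebroid identities then reduce to `d^B X = -L_X Λ` with `L_[X,Y] = [L_X, L_Y]`, to `L_X d^A
u = d^A(ρ_A(X)u)`, and to `Λ(d^A u, d^A u) = 0`. -/

noncomputable section

namespace ELie

/-! ### Smooth sections and functions separate fibre vectors and tangent vectors. -/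

section Geometry

variable {EM : Type*} [NormedAddCommGroup EM] [NormedSpace ℝ EM]
  {H : Type*} [TopologicalSpace H] {I : ModelWithCorners ℝ EM H}
  {M : Type*} [TopologicalSpace M] [ChartedSpace H M]

/-- The derivative `X f` of a smooth function along a smooth vector field, as a smooth function. -/
def dirDeriv [IsManifold I ∞ M] (X : Cₛ^∞⟮I; EM, (TangentSpace I : M → Type _)⟯)
    (f : C^∞⟮I, M; ℝ⟯) : C^∞⟮I, M; ℝ⟯ :=
  ⟨fun x => mvfderiv I f x (X x), by
    have h1 : ContMDiff I.tangent 𝓘(ℝ, ℝ).tangent ∞ (tangentMap I 𝓘(ℝ, ℝ) f) :=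
      f.contMDiff.contMDiff_tangentMap (by simp)
    have h2 := (contMDiff_snd_tangentBundle_modelSpace ℝ 𝓘(ℝ, ℝ) (n := ∞)).comp
      (h1.comp X.contMDiff)
    exact h2⟩

variable [FiniteDimensional ℝ EM] [IsManifold I ∞ M] [T2Space M]

/-- Every vector of a smooth vector bundle is the value of a smooth section. -/
theorem exists_section_apply_eq {F : Type*} [NormedAddCommGroup F] [NormedSpace ℝ F]
    {V : M → Type*} [TopologicalSpace (TotalSpace F V)] [∀ x, AddCommGroup (V x)]
    [∀ x, Module ℝ (V x)] [∀ x, TopologicalSpace (V x)] [FiberBundle F V] [VectorBundle ℝ F V]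
    [ContMDiffVectorBundle ∞ F V I] (x : M) (v : V x) :
    ∃ s : Cₛ^∞⟮I; F, V⟯, s x = v := by
  obtain ⟨U, hU, hs⟩ := FiberBundle.exists_contMDiffOn_extend (k := ∞) I F v
  obtain ⟨W, hWU, hWo, hxW⟩ := mem_nhds_iff.1 hU
  -- The local extension is smooth only on `W`; a bump function supported there globalizes it.
  obtain ⟨f, -, hf⟩ := (SmoothBumpFunction.nhds_basis_tsupport (I := I) x).mem_iff.1
    (hWo.mem_nhds hxW)
  refine ⟨⟨_, ContMDiffOn.smul_section_of_tsupport (f.contMDiff.contMDiffOn (s := W)) hWo hf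
    (hs.mono hWU)⟩, ?_⟩
  show f x • FiberBundle.extend F v x = v
  simp

/-- A tangent vector that annihilates all smooth functions is zero. -/
theorem eq_zero_of_mvfderiv_eq_zero (x : M) (v : TangentSpace I x)
    (h : ∀ f : C^∞⟮I, M; ℝ⟯, mvfderiv I f x v = 0) : v = 0 := by
  obtain ⟨b⟩ : Nonempty (SmoothBumpFunction I x) := inferInstance
  -- The chart, cut off to a global smooth map; its derivative at `x` is the identity, so composing
  -- it with linear functionals detects `v`.
  let g : M → EM := fun y => b y • extChartAt I x y
  have hg : ContMDiff I 𝓘(ℝ, EM) ∞ g := b.contMDiff_smul (contMDiffOn_extChartAt)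
  have hgx : mfderiv I 𝓘(ℝ, EM) g x = mfderiv I 𝓘(ℝ, EM) (extChartAt I x) x := by
    apply Filter.EventuallyEq.mfderiv_eq
    filter_upwards [b.eventuallyEq_one] with y hy
    simp [g, hy]
  have hinj : mfderiv I 𝓘(ℝ, EM) g x v = 0 → v = 0 := by
    rw [hgx, mfderiv_extChartAt_self]
    exact id
  apply hinj
  by_contra hne
  obtain ⟨φ, hφ⟩ : ∃ φ : EM →L[ℝ] ℝ, φ (mfderiv I 𝓘(ℝ, EM) g x v) ≠ 0 :=
    SeparatingDual.exists_ne_zero hne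
  have hφs : ContMDiff 𝓘(ℝ, EM) 𝓘(ℝ, ℝ) ∞ φ := φ.contMDiff
  apply hφ
  have h3 := h ⟨fun y => φ (g y), hφs.comp hg⟩
  have h4 : mvfderiv I (φ ∘ g) x v = mvfderiv 𝓘(ℝ, EM) φ (g x) (mfderiv I 𝓘(ℝ, EM) g x v) :=
    mvfderiv_comp_apply x (hφs.mdifferentiable (by simp) _) (hg.mdifferentiable (by simp) _) v
  have h5 : mvfderiv 𝓘(ℝ, EM) φ (g x) (mfderiv I 𝓘(ℝ, EM) g x v)
      = φ (mfderiv I 𝓘(ℝ, EM) g x v) := by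
    have : mfderiv 𝓘(ℝ, EM) 𝓘(ℝ, ℝ) φ (g x) = φ := by
      rw [mfderiv_eq_fderiv]; exact φ.fderiv
    show (mfderiv 𝓘(ℝ, EM) 𝓘(ℝ, ℝ) φ (g x)) _ = _
    rw [this]
    rfl
  rw [← h5, ← h4]
  exact h3

end Geometry

variable {EM : Type*} [NormedAddCommGroup EM] [NormedSpace ℝ EM]
  {H : Type*} [TopologicalSpace H] {I : ModelWithCorners ℝ EM H}
  {M : Type*} [TopologicalSpace M] [ChartedSpace H M]
  {FA : Type*} [NormedAddCommGroup FA] [NormedSpace ℝ FA]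
  {A : M → Type*} [TopologicalSpace (TotalSpace FA A)] [∀ x, AddCommGroup (A x)]
  [∀ x, Module ℝ (A x)] [∀ x, TopologicalSpace (A x)] [FiberBundle FA A] [VectorBundle ℝ FA A]
  {FB : Type*} [NormedAddCommGroup FB] [NormedSpace ℝ FB]
  {B : M → Type*} [TopologicalSpace (TotalSpace FB B)] [∀ x, AddCommGroup (B x)]
  [∀ x, Module ℝ (B x)] [∀ x, TopologicalSpace (B x)] [FiberBundle FB B] [VectorBundle ℝ FB B]
  {FE : Type*} [NormedAddCommGroup FE] [NormedSpace ℝ FE]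
  {E : M → Type*} [TopologicalSpace (TotalSpace FE E)] [∀ x, AddCommGroup (E x)]
  [∀ x, Module ℝ (E x)] [∀ x, TopologicalSpace (E x)] [FiberBundle FE E] [VectorBundle ℝ FE E]

/-! ### Consequences of nondegeneracy on sections. -/

section Nondegeneracy

variable [FiniteDimensional ℝ EM] [IsManifold I ∞ M] [T2Space M]

/-- The pairing separates the sections of `A`. -/
theorem DualPair.eq_of_forall_pairing_eq [ContMDiffVectorBundle ∞ FB B I]
    (P : DualPair I FA A FB B FE E) {X Y : Cₛ^∞⟮I; FA, A⟯}
    (h : ∀ ξ : Cₛ^∞⟮I; FB, B⟯, P.pairing X ξ = P.pairing Y ξ) : X = Y := by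
  ext x
  refine sub_eq_zero.1 (P.nondeg_left x _ fun b => ?_)
  obtain ⟨ξ, rfl⟩ := exists_section_apply_eq (I := I) (F := FB) x b
  rw [map_sub, LinearMap.sub_apply, sub_eq_zero]
  exact congrArg (fun u : Cₛ^∞⟮I; FE, E⟯ => u x) (h ξ)

/-- The pairing separates the sections of `B`. -/
theorem DualPair.eq_of_forall_pairing_eq' [ContMDiffVectorBundle ∞ FA A I]
    (P : DualPair I FA A FB B FE E) {ξ η : Cₛ^∞⟮I; FB, B⟯}
    (h : ∀ X : Cₛ^∞⟮I; FA, A⟯, P.pairing X ξ = P.pairing X η) : ξ = η :=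
  P.swap.eq_of_forall_pairing_eq h

/-- If `ρ(X) = 0` then the anchor annihilates `X`. -/
theorem Representation.anchor_eq_zero [ContMDiffVectorBundle ∞ FE E I]
    (P : DualPair I FA A FB B FE E) {L : LieAlgebroid I FA A} (ρ : Representation FE E L)
    {X : Cₛ^∞⟮I; FA, A⟯} (h : ∀ u, ρ.op X u = 0) : L.anchor X = 0 := by
  ext x : 1
  -- The symbol of `ρ(X)` determines the anchor only where `E` has a nonzero vector.
  by_cases hE : ∃ e : E x, e ≠ 0
  · obtain ⟨e, he⟩ := hE
    obtain ⟨u, rfl⟩ := exists_section_apply_eq (I := I) (F := FE) x e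
    refine eq_zero_of_mvfderiv_eq_zero x _ fun f => ?_
    have h1 := ρ.leibniz f X u x
    rw [h, h] at h1
    simp only [ContMDiffSection.coe_zero, Pi.zero_apply, smul_zero, zero_add] at h1
    exact (smul_eq_zero.1 h1.symm).resolve_right he
  -- All fibres are modelled on `FE`, so one zero fibre forces `E = 0`; nondegeneracy then makes
  -- every fibre of `A` zero.
  · push Not at hE
    have hF (w : FE) : w = 0 := by
      let e := (trivializationAt FE E x).continuousLinearEquivAt ℝ x
        (FiberBundle.mem_baseSet_trivializationAt' x)
      rw [← e.apply_symm_apply w, hE (e.symm w), map_zero]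
    have hE' (y : M) (v : E y) : v = 0 := by
      let e := (trivializationAt FE E y).continuousLinearEquivAt ℝ y
        (FiberBundle.mem_baseSet_trivializationAt' y)
      rw [← e.symm_apply_apply v, hF (e v), map_zero]
    have hX : X = 0 := by
      ext y
      exact P.nondeg_left y _ fun b => hE' y _
    rw [hX, map_zero]

end Nondegeneracy

section Leibniz

variable [IsManifold I ∞ M]

theorem LieAlgebroid.bracket_smul (L : LieAlgebroid I FA A) (f : C^∞⟮I, M; ℝ⟯)
    (X Y : Cₛ^∞⟮I; FA, A⟯) :
    L.bracket X (f • Y) = f • L.bracket X Y + dirDeriv (L.anchor X) f • Y := by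
  ext x
  exact L.leibniz f X Y x

theorem LieAlgebroid.bracket_swap (L : LieAlgebroid I FA A) (X Y : Cₛ^∞⟮I; FA, A⟯) :
    L.bracket X Y = -L.bracket Y X := by
  have h := L.bracket_self (X + Y)
  simp only [map_add, LinearMap.add_apply, L.bracket_self, zero_add, add_zero] at h
  exact eq_neg_of_add_eq_zero_right h

theorem LieAlgebroid.smul_bracket (L : LieAlgebroid I FA A) (f : C^∞⟮I, M; ℝ⟯)
    (X Y : Cₛ^∞⟮I; FA, A⟯) :
    L.bracket (f • X) Y = f • L.bracket X Y - dirDeriv (L.anchor Y) f • X := by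
  rw [L.bracket_swap, L.bracket_smul, L.bracket_swap Y X, smul_neg]
  abel

theorem Representation.op_smul {L : LieAlgebroid I FA A} (ρ : Representation FE E L)
    (f : C^∞⟮I, M; ℝ⟯) (X : Cₛ^∞⟮I; FA, A⟯) (u : Cₛ^∞⟮I; FE, E⟯) :
    ρ.op X (f • u) = f • ρ.op X u + dirDeriv (L.anchor X) f • u := by
  ext x
  exact ρ.leibniz f X u x

end Leibniz

/-! ### The Cartan recursion for the coboundary. -/

section Coboundary

theorem removeNth_succ_cons {α : Type*} {n : ℕ} (a : α) (v : Fin (n + 1) → α) (i : Fin (n + 1)) :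
    i.succ.removeNth (Fin.cons a v : Fin (n + 2) → α) = Fin.cons a (i.removeNth v) := by
  ext j
  refine Fin.cases ?_ (fun j => ?_) j
  · simp [Fin.removeNth]
  · simp [Fin.removeNth]

/-- Moving `Y` from the front to slot `j` passes `j` arguments. -/
theorem Form.map_cons_removeNth {k : ℕ} (μ : Form I FA A FE E (k + 1)) (Y : Cₛ^∞⟮I; FA, A⟯)
    (R : Fin (k + 1) → Cₛ^∞⟮I; FA, A⟯) (j : Fin (k + 1)) :
    μ (Fin.cons Y (j.removeNth R)) = (-1 : ℝ) ^ (j : ℕ) • μ (Function.update R j Y) := by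
  have h := μ.neg_one_pow_smul_map_insertNth j Y (j.removeNth R)
  rw [Fin.insertNth_removeNth] at h
  refine h.symm.trans ?_
  rcases Nat.even_or_odd (j : ℕ) with hj | hj
  · simp [hj.neg_one_pow]
  · simp [hj.neg_one_pow]

theorem Form.map_cons_cons {k : ℕ} (μ : Form I FA A FE E (k + 2)) (X Y : Cₛ^∞⟮I; FA, A⟯)
    (v : Fin k → Cₛ^∞⟮I; FA, A⟯) :
    μ (Fin.cons X (Fin.cons Y v)) = -μ (Fin.cons Y (Fin.cons X v)) := by
  rw [← μ.map_swap (Fin.cons Y (Fin.cons X v)) (i := 0) (j := 1) (by simp)]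
  congr 1
  ext i : 1
  refine Fin.cases ?_ (fun i => Fin.cases ?_ (fun i => ?_) i) i
  · simp
  · simp
  · rw [Function.comp_apply, Equiv.swap_apply_of_ne_of_ne]
    · rfl
    · exact Fin.succ_ne_zero _
    · exact fun h => Fin.succ_ne_zero _ (Fin.succ_injective _ h)

variable [IsManifold I ∞ M] {L : LieAlgebroid I FA A} (ρ : Representation FE E L)

/-- Cartan's formula `d = L_X - d ∘ i_X` in the first slot, as a recursion for the coboundary. -/
theorem coboundary_cons (k : ℕ) (μ : Form I FA A FE E (k + 1)) (X : Cₛ^∞⟮I; FA, A⟯)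
    (R : Fin (k + 1) → Cₛ^∞⟮I; FA, A⟯) :
    coboundary ρ (k + 1) μ (Fin.cons X R) =
      ρ.op X (μ R) - ∑ i, μ (Function.update R i (L.bracket X (R i)))
        - coboundary ρ k (μ.curryLeft X) R := by
  have hterm (j : Fin (k + 1)) (Y : Cₛ^∞⟮I; FA, A⟯) :
      (-1 : ℝ) ^ ((j : ℕ) + 1) • μ (Fin.cons Y (j.removeNth R)) = -μ (Function.update R j Y) := by
    rw [Form.map_cons_removeNth, smul_smul, ← pow_add, Odd.neg_one_pow ⟨j, by ring⟩, neg_one_smul]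
  cases k with
  | zero =>
    have e1 : (1 : Fin 2).removeNth (Fin.cons X R : Fin 2 → Cₛ^∞⟮I; FA, A⟯) = ![X] := by
      ext i : 1
      fin_cases i
      rfl
    have e2 (Y : Cₛ^∞⟮I; FA, A⟯) : Function.update R 0 Y = ![Y] := by
      ext i : 1
      fin_cases i
      rfl
    have hc : μ.curryLeft X ![] = μ ![X] := rfl
    simp only [coboundary, hc]
    simp [Fin.sum_univ_two, e1, e2]
    abel
  | succ k =>
    have hc (v : Fin (k + 1) → Cₛ^∞⟮I; FA, A⟯) : μ.curryLeft X v = μ (Fin.cons X v) := rfl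
    simp only [coboundary, hc]
    rw [Fin.sum_univ_succ]
    rw [Fin.sum_univ_succ (n := k + 2) (f := fun j => ∑ i : Fin (k + 2), _)]
    simp only [Fin.not_lt_zero, if_false, Finset.sum_const_zero, zero_add, Fin.cons_zero,
      Fin.cons_succ, Fin.val_zero, pow_zero, one_smul, Fin.val_succ, removeNth_succ_cons]
    simp only [Fin.sum_univ_succ (n := k + 1) (f := fun i : Fin (k + 2) => ite _ _ _)]
    simp only [Fin.castSucc_zero, Fin.succ_pos, if_true, Fin.val_zero, Fin.val_succ, zero_add,
      ← Fin.succ_castSucc, Fin.removeNth_zero, Fin.tail_cons, Fin.succ_lt_succ_iff, Fin.cons_zero, Fin.cons_succ]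
    -- Terms of the double sum pairing `X` with `R j` give the bracket part of `L_X`. In the others
    -- both indices shift by one, so the sign is unchanged; moving `X` in front of the bracket then
    -- gives the minus of `-d i_X`.
    refine (congrArg₂ (· + ·) (congrArg (ρ.op X (μ R) + ·) (?h1 : _ = -(∑ i : Fin (k + 2),
      (-1 : ℝ) ^ (i : ℕ) • ρ.op (R i) (μ (Fin.cons X (i.removeNth R)))))) (?h2 : _ =
      ∑ j : Fin (k + 2), (-μ (Function.update R j (L.bracket X (R j))) -
        ∑ i : Fin (k + 1), if i.castSucc < j then (-1 : ℝ) ^ ((i : ℕ) + (j : ℕ)) •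
          μ (Fin.cons X (Fin.cons (L.bracket (R i.castSucc) (R j)) (i.removeNth (j.removeNth R))))
        else 0))).trans ?_
    · rw [← Finset.sum_neg_distrib]
      refine Finset.sum_congr rfl fun i _ => ?_
      rw [pow_succ, mul_neg_one, neg_smul]
    · refine Finset.sum_congr rfl fun j _ => ?_
      rw [sub_eq_add_neg, ← Finset.sum_neg_distrib]
      refine congrArg₂ (· + ·) (hterm j _) (Finset.sum_congr rfl fun i _ => ?_)
      split_ifs
      · refine (congrArg (fun v => (-1 : ℝ) ^ ((i : ℕ) + 1 + ((j : ℕ) + 1)) •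
          μ (Fin.cons (L.bracket (R i.castSucc) (R j)) v))
          (removeNth_succ_cons X _ i)).trans ?_
        rw [Form.map_cons_cons, smul_neg]
        congr 2
        ring
      · simp
    · rw [Finset.sum_sub_distrib, Finset.sum_neg_distrib]
      abel

end Coboundary

/-! ### Lie derivatives of forms; the coboundary of a form is a form. -/

section LieForm

/-- Isolates slot `j` in the sum of the Lie derivative: `D` hits the new entry once, and all other
terms keep `Y` in slot `j`, where `μ` is linear. -/
theorem sum_update_update {k : ℕ} (μ : Form I FA A FE E k) (D : Cₛ^∞⟮I; FA, A⟯ → Cₛ^∞⟮I; FA, A⟯)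
    (m : Fin k → Cₛ^∞⟮I; FA, A⟯) (j : Fin k) (Y : Cₛ^∞⟮I; FA, A⟯) :
    ∑ i, μ (Function.update (Function.update m j Y) i (D (Function.update m j Y i))) =
      μ (Function.update m j (D Y)) +
        ∑ i ∈ Finset.univ.erase j, μ (Function.update (Function.update m i (D (m i))) j Y) := by
  rw [← Finset.add_sum_erase _ _ (Finset.mem_univ j)]
  congr 1
  · simp
  · refine Finset.sum_congr rfl fun i hi => ?_
    have hij := Finset.ne_of_mem_erase hi
    rw [Function.update_of_ne hij, Function.update_comm hij.symm]

theorem Form.map_update_add_map_update {k : ℕ} (μ : Form I FA A FE E k)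
    (v : Fin k → Cₛ^∞⟮I; FA, A⟯) {i j : Fin k} (h : v i = v j) (hij : i ≠ j)
    (Y : Cₛ^∞⟮I; FA, A⟯) :
    μ (Function.update v i Y) + μ (Function.update v j Y) = 0 := by
  rw [← μ.map_add_swap (Function.update v i Y) hij]
  congr 2
  ext l : 1
  rw [Function.comp_apply]
  by_cases h1 : l = i
  · subst h1
    simp [hij, hij.symm, h]
  by_cases h2 : l = j
  · subst h2
    simp
  rw [Equiv.swap_apply_of_ne_of_ne h1 h2]
  simp [h1, h2]

variable [IsManifold I ∞ M] {L : LieAlgebroid I FA A} (ρ : Representation FE E L)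

/-- The Lie derivative of a form. -/
def lieForm {k : ℕ} (X : Cₛ^∞⟮I; FA, A⟯) (μ : Form I FA A FE E k) : Form I FA A FE E k where
  toFun R := ρ.op X (μ R) - ∑ i, μ (Function.update R i (L.bracket X (R i)))
  map_update_add' {dec} m j Y Z := by
    cases Subsingleton.elim dec (instDecidableEqFin k)
    simp only [sum_update_update, μ.map_update_add, map_add, Finset.sum_add_distrib]
    abel
  -- The derivative of `f` arises from `ρ(X)` and from `[X, fY]`, with opposite signs.
  map_update_smul' {dec} m j f Y := by
    cases Subsingleton.elim dec (instDecidableEqFin k)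
    simp only [sum_update_update, μ.map_update_add, μ.map_update_smul, L.bracket_smul, ρ.op_smul,
      ← Finset.smul_sum, smul_sub, smul_add]
    abel
  -- Only the terms of slots `i` and `j` can survive; they differ by a transposition and cancel.
  map_eq_zero_of_eq' v i j h hij := by
    rw [μ.map_eq_zero_of_eq v h hij, map_zero, zero_sub, neg_eq_zero,
      ← Finset.add_sum_erase _ _ (Finset.mem_univ i),
      ← Finset.add_sum_erase _ _ (Finset.mem_erase.2 ⟨hij.symm, Finset.mem_univ j⟩),
      Finset.sum_eq_zero, add_zero, ← h]
    · exact μ.map_update_add_map_update v h hij _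
    · intro l hl
      simp only [Finset.mem_erase] at hl
      refine μ.map_eq_zero_of_eq _ ?_ hij
      rw [Function.update_of_ne hl.2.1.symm, Function.update_of_ne hl.1.symm, h]

theorem lieForm_apply {k : ℕ} (X : Cₛ^∞⟮I; FA, A⟯) (μ : Form I FA A FE E k)
    (R : Fin k → Cₛ^∞⟮I; FA, A⟯) :
    lieForm ρ X μ R = ρ.op X (μ R) - ∑ i, μ (Function.update R i (L.bracket X (R i))) := rfl

theorem lieForm_cons {k : ℕ} (X Y : Cₛ^∞⟮I; FA, A⟯) (μ : Form I FA A FE E (k + 1))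
    (R : Fin k → Cₛ^∞⟮I; FA, A⟯) :
    lieForm ρ X μ (Fin.cons Y R) =
      ρ.op X (μ (Fin.cons Y R)) - μ (Fin.cons (L.bracket X Y) R)
        - ∑ i, μ (Fin.cons Y (Function.update R i (L.bracket X (R i)))) := by
  rw [lieForm_apply, Fin.sum_univ_succ]
  simp only [Fin.cons_zero, Fin.cons_succ, Fin.update_cons_zero, ← Fin.cons_update]
  abel

theorem coboundary_add (k : ℕ) (μ ν : Form I FA A FE E k)
    (R : Fin (k + 1) → Cₛ^∞⟮I; FA, A⟯) :
    coboundary ρ k (μ + ν) R = coboundary ρ k μ R + coboundary ρ k ν R := by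
  cases k with
  | zero => simp [coboundary]
  | succ k =>
    have h (p : Prop) [Decidable p] (a b : Cₛ^∞⟮I; FE, E⟯) :
        (if p then a + b else 0) = (if p then a else 0) + (if p then b else 0) := by
      split_ifs <;> simp
    simp only [coboundary, AlternatingMap.add_apply, map_add, smul_add, Finset.sum_add_distrib, h]
    abel

theorem coboundary_zero (k : ℕ) (R : Fin (k + 1) → Cₛ^∞⟮I; FA, A⟯) :
    coboundary ρ k (0 : Form I FA A FE E k) R = 0 := by
  have h := coboundary_add ρ k 0 0 R
  rwa [add_zero, left_eq_add] at h

theorem coboundary_cons_eq_lieForm_sub (k : ℕ) (μ : Form I FA A FE E (k + 1))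
    (X : Cₛ^∞⟮I; FA, A⟯) (R : Fin (k + 1) → Cₛ^∞⟮I; FA, A⟯) :
    coboundary ρ (k + 1) μ (Fin.cons X R) =
      lieForm ρ X μ R - coboundary ρ k (μ.curryLeft X) R :=
  coboundary_cons ρ k μ X R

/-- Since `[X, X] = 0`, `L_X` commutes with `i_X`. Applying Cartan's formula twice, the `L_X i_X μ`
terms cancel and `i_X i_X μ = 0`. -/
theorem coboundary_cons_cons_self (k : ℕ) (μ : Form I FA A FE E (k + 1)) (X : Cₛ^∞⟮I; FA, A⟯)
    (R : Fin k → Cₛ^∞⟮I; FA, A⟯) :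
    coboundary ρ (k + 1) μ (Fin.cons X (Fin.cons X R)) = 0 := by
  have h0 : μ (Fin.cons 0 R) = 0 := μ.map_coord_zero 0 rfl
  rw [coboundary_cons_eq_lieForm_sub, lieForm_cons, L.bracket_self, h0, sub_zero]
  cases k with
  | zero =>
    rw [Finset.univ_eq_empty, Finset.sum_empty, sub_zero, sub_eq_zero, coboundary]
    have e : (Fin.cons X R : Fin 1 → Cₛ^∞⟮I; FA, A⟯) = Matrix.vecCons X ![] := by
      rw [Subsingleton.elim R ![]]
      rfl
    rw [e]
    rfl
  | succ k =>
    rw [coboundary_cons, AlternatingMap.curryLeft_same, coboundary_zero, sub_zero]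
    exact sub_self _

/-- The coboundary of a form is a form. -/
theorem exists_form_eq_coboundary (k : ℕ) (μ : Form I FA A FE E k) :
    ∃ ν : Form I FA A FE E (k + 1), ∀ R, ν R = coboundary ρ k μ R := by
  induction k with
  | zero =>
    refine ⟨AlternatingMap.ofSubsingleton _ _ _ (0 : Fin 1)
      { toFun := fun X => ρ.op X (μ ![])
        map_add' := fun X Y => by simp
        map_smul' := fun f X => ρ.smul_op f X _ }, fun R => rfl⟩
  | succ k ih =>
    choose D hD using fun X => ih (μ.curryLeft X)
    -- This is `i_X dμ`, already a form in the remaining arguments by induction; only the dependence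
    -- on `X` is left to check.
    let G (X : Cₛ^∞⟮I; FA, A⟯) : Form I FA A FE E (k + 1) := lieForm ρ X μ - D X
    have hG (X R) : G X R = coboundary ρ (k + 1) μ (Fin.cons X R) := by
      rw [coboundary_cons_eq_lieForm_sub, ← hD]
      rfl
    have hself (X R) : G X (Fin.cons X R) = 0 := by
      rw [hG, coboundary_cons_cons_self]
    have hadd (X Y) : G (X + Y) = G X + G Y := by
      ext1 R
      simp only [hG, AlternatingMap.add_apply, coboundary_cons_eq_lieForm_sub, map_add,
        coboundary_add, lieForm_apply, LinearMap.add_apply, μ.map_update_add,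
        Finset.sum_add_distrib]
      abel
    have hswap (X Y R) : G X (Fin.cons Y R) = -G Y (Fin.cons X R) := by
      have h := hself (X + Y) R
      have h1 (Z : Cₛ^∞⟮I; FA, A⟯) :
          G Z (Fin.cons (X + Y) R) = G Z (Fin.cons X R) + G Z (Fin.cons Y R) :=
        (G Z).map_vecCons_add R X Y
      rw [hadd, AlternatingMap.add_apply, h1, h1, hself, hself, zero_add, add_zero] at h
      exact eq_neg_of_add_eq_zero_left h
    -- Antisymmetry moves `f • X` into a slot where linearity is known, so no derivative of `f` need
    -- be computed.
    have hsmul (f : C^∞⟮I, M; ℝ⟯) (X) : G (f • X) = f • G X := by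
      ext1 R
      rw [← Fin.cons_self_tail R, hswap, AlternatingMap.smul_apply, hswap X, smul_neg]
      exact congrArg _ ((G (R 0)).map_vecCons_smul (Fin.tail R) f X)
    let Gl : Cₛ^∞⟮I; FA, A⟯ →ₗ[C^∞⟮I, M; ℝ⟯] MultilinearMap C^∞⟮I, M; ℝ⟯
        (fun _ : Fin (k + 1) => Cₛ^∞⟮I; FA, A⟯) Cₛ^∞⟮I; FE, E⟯ :=
      { toFun := fun X => (G X).toMultilinearMap
        map_add' := fun X Y => by rw [hadd]; rfl
        map_smul' := fun f X => by rw [hsmul]; rfl }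
    have hzero (X : Cₛ^∞⟮I; FA, A⟯) (R) (j : Fin (k + 1)) (h : R j = X) : G X R = 0 := by
      have h1 := (G X).map_insertNth j X (j.removeNth R)
      rw [Fin.insertNth_removeNth, ← h, Function.update_eq_self, h] at h1
      rw [h1]
      refine (congrArg _ (hself X _)).trans ?_
      exact smul_zero _
    refine ⟨{ Gl.uncurryLeft with map_eq_zero_of_eq' := ?_ }, fun R => ?_⟩
    · intro v i j h hij
      change G (v 0) (Fin.tail v) = 0
      induction i using Fin.cases with
      | zero =>
        induction j using Fin.cases with
        | zero => exact absurd rfl hij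
        | succ j => exact hzero _ _ j h.symm
      | succ i =>
        induction j using Fin.cases with
        | zero => exact hzero _ _ i h
        | succ j => exact (G (v 0)).map_eq_zero_of_eq _ h fun e => hij (congrArg _ e)
    · change G (R 0) (Fin.tail R) = _
      rw [hG, Fin.cons_self_tail]

end LieForm

/-! ### Invariance of a representation, reduced to low degree. -/

namespace DualPair

/-- The distinguished argument moves from last to first, as the Cartan recursion needs; the sign
`(-1)^k` is absorbed into `ξ`. -/
theorem valuedIn_succ_iff (P : DualPair I FA A FB B FE E) (k : ℕ)
    (μ : Form I FA A FE E (k + 1)) :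
    P.ValuedIn (k + 1) μ ↔ ∀ R : Fin k → Cₛ^∞⟮I; FA, A⟯, ∃ ξ : Cₛ^∞⟮I; FB, B⟯,
      ∀ Y : Cₛ^∞⟮I; FA, A⟯, μ (Fin.cons Y R) = P.pairing Y ξ := by
  have h (R : Fin k → Cₛ^∞⟮I; FA, A⟯) (Y : Cₛ^∞⟮I; FA, A⟯) :
      μ (Fin.snoc (α := fun _ => Cₛ^∞⟮I; FA, A⟯) R Y) = (-1) ^ k • μ (Fin.cons Y R) := by
    have h1 := μ.map_insertNth (Fin.last k) Y R
    rwa [Fin.insertNth_last', Fin.val_last] at h1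
  refine forall_congr' fun R => ?_
  simp only [h]
  rcases Nat.even_or_odd k with hk | hk
  · simp [hk.neg_one_pow]
  · simp only [hk.neg_one_pow, neg_smul, one_smul]
    constructor
    · rintro ⟨ξ, hξ⟩
      exact ⟨-ξ, fun Y => by rw [map_neg, ← hξ, neg_neg]⟩
    · rintro ⟨ξ, hξ⟩
      exact ⟨-ξ, fun Y => by rw [map_neg, ← hξ]⟩

theorem ValuedIn.curryLeft {P : DualPair I FA A FB B FE E} {k : ℕ}
    {μ : Form I FA A FE E (k + 1)} (h : P.ValuedIn (k + 1) μ) (X : Cₛ^∞⟮I; FA, A⟯) :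
    P.ValuedIn k (μ.curryLeft X) := by
  cases k with
  | zero => trivial
  | succ k =>
    rw [valuedIn_succ_iff] at h ⊢
    intro R
    obtain ⟨ξ, hξ⟩ := h (Fin.cons X R)
    refine ⟨-ξ, fun Y => ?_⟩
    rw [map_neg, ← hξ]
    exact Form.map_cons_cons μ X Y R

section Invariance

variable [IsManifold I ∞ M]

/-- A representation is invariant as soon as the differentials of sections of `E` and the Lie
derivatives of sections of `B` are sections of `B`. -/
theorem invariant_of_exists {P : DualPair I FA A FB B FE E} {L : LieAlgebroid I FA A}
    {ρ : Representation FE E L}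
    (hd : ∀ u : Cₛ^∞⟮I; FE, E⟯, ∃ ξ : Cₛ^∞⟮I; FB, B⟯, ∀ X, ρ.op X u = P.pairing X ξ)
    (hl : ∀ (X : Cₛ^∞⟮I; FA, A⟯) (ξ : Cₛ^∞⟮I; FB, B⟯), ∃ η : Cₛ^∞⟮I; FB, B⟯, ∀ Y,
      ρ.op X (P.pairing Y ξ) - P.pairing (L.bracket X Y) ξ = P.pairing Y η) :
    P.Invariant ρ := by
  intro k μ hμ
  obtain ⟨ν, hν⟩ := exists_form_eq_coboundary ρ k μ
  refine ⟨ν, ?_, hν⟩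
  rw [valuedIn_succ_iff]
  induction k with
  | zero =>
    intro R
    obtain ⟨ξ, hξ⟩ := hd (μ ![])
    exact ⟨ξ, fun Y => by rw [hν, ← hξ]; rfl⟩
  | succ k ih =>
    intro R
    set X := R 0
    set R' := Fin.tail R
    have hR : R = Fin.cons X R' := (Fin.cons_self_tail R).symm
    obtain ⟨ν', hν'⟩ := exists_form_eq_coboundary ρ k (μ.curryLeft X)
    obtain ⟨ξ', hξ'⟩ := ih (μ.curryLeft X) (hμ.curryLeft X) ν' hν' R'
    rw [valuedIn_succ_iff] at hμ
    choose ξ hξ using hμ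
    obtain ⟨η, hη⟩ := hl X (ξ R')
    -- The outer minus comes from exchanging `Y` and `X`. The three terms represent those of
    -- Cartan's formula, the last one by induction.
    refine ⟨-(η - ∑ i, ξ (Function.update R' i (L.bracket X (R' i))) - ξ'), fun Y => ?_⟩
    rw [hR, Form.map_cons_cons, hν, coboundary_cons_eq_lieForm_sub, lieForm_cons, ← hν', hξ']
    simp only [map_neg, map_sub, map_sum, ← hη, hξ]

end Invariance

/-! ### Cartan calculus on sections of `B`. -/

section Calculus

variable [IsManifold I ∞ M] {L : LieAlgebroid I FA A} {ρ : Representation FE E L}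
  {P : DualPair I FA A FB B FE E}

theorem _root_.ELie.LieAlgebroid.bracket_bracket (L : LieAlgebroid I FA A)
    (X Y Z : Cₛ^∞⟮I; FA, A⟯) :
    L.bracket (L.bracket X Y) Z =
      L.bracket X (L.bracket Y Z) - L.bracket Y (L.bracket X Z) := by
  have h := L.jacobi X Y Z
  rw [L.bracket_swap (L.bracket Y Z), L.bracket_swap (L.bracket Z X), L.bracket_swap Z X,
    map_neg] at h
  rw [← sub_eq_zero, ← h]
  abel

variable [FiniteDimensional ℝ EM] [T2Space M] [ContMDiffVectorBundle ∞ FA A I]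

theorem Invariant.lie_add_left (hρ : P.Invariant ρ) (X Y : Cₛ^∞⟮I; FA, A⟯)
    (ξ : Cₛ^∞⟮I; FB, B⟯) : P.lie ρ (X + Y) ξ = P.lie ρ X ξ + P.lie ρ Y ξ := by
  refine P.eq_of_forall_pairing_eq' fun Z => ?_
  simp only [map_add, LinearMap.add_apply, hρ.pairing_lie]
  abel

theorem Invariant.lie_add_right (hρ : P.Invariant ρ) (X : Cₛ^∞⟮I; FA, A⟯)
    (ξ η : Cₛ^∞⟮I; FB, B⟯) : P.lie ρ X (ξ + η) = P.lie ρ X ξ + P.lie ρ X η := by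
  refine P.eq_of_forall_pairing_eq' fun Z => ?_
  simp only [map_add, hρ.pairing_lie]
  abel

theorem Invariant.dE_add (hρ : P.Invariant ρ) (u v : Cₛ^∞⟮I; FE, E⟯) :
    P.dE ρ (u + v) = P.dE ρ u + P.dE ρ v := by
  refine P.eq_of_forall_pairing_eq' fun Z => ?_
  simp only [map_add, hρ.pairing_dE]

theorem Invariant.lie_dE (hρ : P.Invariant ρ) (X : Cₛ^∞⟮I; FA, A⟯) (u : Cₛ^∞⟮I; FE, E⟯) :
    P.lie ρ X (P.dE ρ u) = P.dE ρ (ρ.op X u) := by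
  refine P.eq_of_forall_pairing_eq' fun Z => ?_
  simp only [hρ.pairing_lie, hρ.pairing_dE, ρ.flat]
  abel

theorem Invariant.lie_bracket (hρ : P.Invariant ρ) (X Y : Cₛ^∞⟮I; FA, A⟯)
    (ξ : Cₛ^∞⟮I; FB, B⟯) :
    P.lie ρ (L.bracket X Y) ξ = P.lie ρ X (P.lie ρ Y ξ) - P.lie ρ Y (P.lie ρ X ξ) := by
  refine P.eq_of_forall_pairing_eq' fun Z => ?_
  simp only [hρ.pairing_lie, map_sub, LinearMap.sub_apply, ρ.flat, L.bracket_bracket]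
  abel

end Calculus

/-! ### The bundle map defined by `Λ`. -/

section Sharp

variable {P : DualPair I FA A FB B FE E} {Λ : Form I FB B FE E 2}

theorem ValuedIn.pairing_sharp (hΛ : P.swap.ValuedIn 2 Λ) (ξ η : Cₛ^∞⟮I; FB, B⟯) :
    P.pairing (P.sharp Λ ξ) η = Λ ![ξ, η] := by
  refine P.swap.pairing_repr (φ := fun η => Λ ![ξ, η]) ?_ η
  obtain ⟨X, hX⟩ := hΛ ![ξ]
  refine ⟨X, fun ζ => ?_⟩
  rw [← hX ζ]
  congr 1
  ext i : 1
  fin_cases i <;> rfl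

theorem ValuedIn.pairing_sharp_swap (hΛ : P.swap.ValuedIn 2 Λ) (ξ η : Cₛ^∞⟮I; FB, B⟯) :
    P.pairing (P.sharp Λ ξ) η = -P.pairing (P.sharp Λ η) ξ := by
  rw [hΛ.pairing_sharp, hΛ.pairing_sharp]
  exact Form.map_cons_cons Λ ξ η ![]

variable [FiniteDimensional ℝ EM] [T2Space M] [IsManifold I ∞ M] [ContMDiffVectorBundle ∞ FB B I]

/-- Antisymmetry transfers linearity in `ξ` to the second argument of the pairing. -/
theorem ValuedIn.sharp_add (hΛ : P.swap.ValuedIn 2 Λ) (ξ η : Cₛ^∞⟮I; FB, B⟯) :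
    P.sharp Λ (ξ + η) = P.sharp Λ ξ + P.sharp Λ η := by
  refine P.eq_of_forall_pairing_eq fun ζ => ?_
  simp only [map_add, LinearMap.add_apply]
  rw [hΛ.pairing_sharp_swap, hΛ.pairing_sharp_swap ξ, hΛ.pairing_sharp_swap η, map_add, neg_add]

theorem ValuedIn.sharp_smul (hΛ : P.swap.ValuedIn 2 Λ) (f : C^∞⟮I, M; ℝ⟯)
    (ξ : Cₛ^∞⟮I; FB, B⟯) : P.sharp Λ (f • ξ) = f • P.sharp Λ ξ := by
  refine P.eq_of_forall_pairing_eq fun ζ => ?_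
  simp only [map_smul, LinearMap.smul_apply]
  rw [hΛ.pairing_sharp_swap, hΛ.pairing_sharp_swap ξ, map_smul, smul_neg]

/-- The bundle map `Λ_♮` as a linear map. -/
def sharpHom (hΛ : P.swap.ValuedIn 2 Λ) :
    Cₛ^∞⟮I; FB, B⟯ →ₗ[C^∞⟮I, M; ℝ⟯] Cₛ^∞⟮I; FA, A⟯ where
  toFun := P.sharp Λ
  map_add' := hΛ.sharp_add
  map_smul' := hΛ.sharp_smul

end Sharp

/-! ### The bracket `[·, ·]_Λ`, its defect and the Jacobi identity. -/

section Bracket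

variable [IsManifold I ∞ M] {L : LieAlgebroid I FA A} {ρ : Representation FE E L}
  {P : DualPair I FA A FB B FE E} {Λ : Form I FB B FE E 2}

theorem pairing_bracketOf (hρ : P.Invariant ρ) (hΛ : P.swap.ValuedIn 2 Λ)
    (Y : Cₛ^∞⟮I; FA, A⟯) (ξ η : Cₛ^∞⟮I; FB, B⟯) :
    P.pairing Y (P.bracketOf ρ Λ ξ η) =
      ρ.op (P.sharp Λ ξ) (P.pairing Y η) - P.pairing (L.bracket (P.sharp Λ ξ) Y) η
        - (ρ.op (P.sharp Λ η) (P.pairing Y ξ) - P.pairing (L.bracket (P.sharp Λ η) Y) ξ)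
        - ρ.op Y (P.pairing (P.sharp Λ ξ) η) := by
  rw [bracketOf, map_sub, map_sub, hρ.pairing_lie, hρ.pairing_lie, hρ.pairing_dE,
    hΛ.pairing_sharp]

/-- The defect `[Λξ, Λη] - Λ[ξ, η]_Λ`, which is half of `[Λ, Λ]_♮(ξ, η)`. -/
def sharpDefect (P : DualPair I FA A FB B FE E) (ρ : Representation FE E L)
    (Λ : Form I FB B FE E 2) (ξ η : Cₛ^∞⟮I; FB, B⟯) : Cₛ^∞⟮I; FA, A⟯ :=
  L.bracket (P.sharp Λ ξ) (P.sharp Λ η) - P.sharp Λ (P.bracketOf ρ Λ ξ η)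

/-- Half of `[Λ, Λ]`, on sections. -/
def halfSchouten (P : DualPair I FA A FB B FE E) (ρ : Representation FE E L)
    (Λ : Form I FB B FE E 2) (ξ η ζ : Cₛ^∞⟮I; FB, B⟯) : Cₛ^∞⟮I; FE, E⟯ :=
  P.pairing (P.sharp Λ ζ) (P.lie ρ (P.sharp Λ ξ) η)
    + P.pairing (P.sharp Λ ξ) (P.lie ρ (P.sharp Λ η) ζ)
    + P.pairing (P.sharp Λ η) (P.lie ρ (P.sharp Λ ζ) ξ)

theorem halfSchouten_cyclic (ξ η ζ : Cₛ^∞⟮I; FB, B⟯) :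
    P.halfSchouten ρ Λ ξ η ζ = P.halfSchouten ρ Λ η ζ ξ := by
  simp only [halfSchouten]
  abel

theorem schouten_self (ξ : Fin 3 → Cₛ^∞⟮I; FB, B⟯) :
    P.schouten ρ Λ Λ ξ = (2 : ℝ) • P.halfSchouten ρ Λ (ξ 0) (ξ 1) (ξ 2) := by
  simp only [schouten, halfSchouten, two_smul]
  abel

theorem halfSchouten_eq (hρ : P.Invariant ρ) (hΛ : P.swap.ValuedIn 2 Λ)
    (ξ η ζ : Cₛ^∞⟮I; FB, B⟯) :
    P.halfSchouten ρ Λ ξ η ζ =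
      P.pairing (L.bracket (P.sharp Λ ξ) (P.sharp Λ η)) ζ
        + P.pairing (L.bracket (P.sharp Λ η) (P.sharp Λ ζ)) ξ
        + P.pairing (L.bracket (P.sharp Λ ζ) (P.sharp Λ ξ)) η
        - ρ.op (P.sharp Λ ξ) (P.pairing (P.sharp Λ η) ζ)
        - ρ.op (P.sharp Λ η) (P.pairing (P.sharp Λ ζ) ξ)
        - ρ.op (P.sharp Λ ζ) (P.pairing (P.sharp Λ ξ) η) := by
  rw [halfSchouten, hρ.pairing_lie, hρ.pairing_lie, hρ.pairing_lie,
    L.bracket_swap (P.sharp Λ η) (P.sharp Λ ξ), L.bracket_swap (P.sharp Λ ζ) (P.sharp Λ η),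
    L.bracket_swap (P.sharp Λ ξ) (P.sharp Λ ζ), hΛ.pairing_sharp_swap ζ η,
    hΛ.pairing_sharp_swap ξ ζ, hΛ.pairing_sharp_swap η ξ]
  simp only [map_neg, LinearMap.neg_apply]
  abel

/-- The link between the Schouten bracket and the failure of `Λ` to preserve brackets, through which
(1) is used. -/
theorem pairing_sharpDefect (hρ : P.Invariant ρ) (hΛ : P.swap.ValuedIn 2 Λ)
    (ξ η ζ : Cₛ^∞⟮I; FB, B⟯) :
    P.pairing (P.sharpDefect ρ Λ ξ η) ζ = P.halfSchouten ρ Λ ξ η ζ := by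
  rw [sharpDefect, map_sub, LinearMap.sub_apply, hΛ.pairing_sharp_swap _ ζ,
    pairing_bracketOf hρ hΛ, halfSchouten_eq hρ hΛ, L.bracket_swap (P.sharp Λ ζ) (P.sharp Λ ξ),
    hΛ.pairing_sharp_swap ζ ξ, hΛ.pairing_sharp_swap ζ η]
  simp only [map_neg, LinearMap.neg_apply]
  abel

/-- Condition (2), divided by two, as a Leibniz rule. -/
theorem op_halfSchouten
    (h : ∀ X ξ, P.lieMulti ρ X (P.schouten ρ Λ Λ) ξ = 0) (Y : Cₛ^∞⟮I; FA, A⟯)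
    (ξ η ζ : Cₛ^∞⟮I; FB, B⟯) :
    ρ.op Y (P.halfSchouten ρ Λ ξ η ζ) = P.halfSchouten ρ Λ (P.lie ρ Y ξ) η ζ
      + P.halfSchouten ρ Λ ξ (P.lie ρ Y η) ζ + P.halfSchouten ρ Λ ξ η (P.lie ρ Y ζ) := by
  have h1 := h Y ![ξ, η, ζ]
  simp only [lieMulti, schouten_self, Fin.sum_univ_three, map_smul] at h1
  rw [← smul_add, ← smul_add, ← smul_sub] at h1
  exact sub_eq_zero.1 ((smul_eq_zero.1 h1).resolve_left two_ne_zero)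

/-- Substitute `Λ[ξ, η]_Λ = [Λξ, Λη] - N`. By (1), `ρ(N)` drops out; the two terms `ρ(Y)⟨N, ζ⟩`
cancel, leaving `N` only in `⟨N, L_Y ζ⟩`. -/
theorem pairing_bracketOf_bracketOf (hρ : P.Invariant ρ) (hΛ : P.swap.ValuedIn 2 Λ)
    (h1 : ∀ ξ η u, ρ.op (P.sharpDefect ρ Λ ξ η) u = 0) (Y : Cₛ^∞⟮I; FA, A⟯)
    (ξ η ζ : Cₛ^∞⟮I; FB, B⟯) :
    P.pairing Y (P.bracketOf ρ Λ ζ (P.bracketOf ρ Λ ξ η)) =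
      ρ.op (P.sharp Λ ζ) (P.pairing Y (P.bracketOf ρ Λ ξ η))
        - P.pairing (L.bracket (P.sharp Λ ζ) Y) (P.bracketOf ρ Λ ξ η)
        - P.pairing Y (P.lie ρ (L.bracket (P.sharp Λ ξ) (P.sharp Λ η)) ζ)
        + ρ.op Y (P.pairing (L.bracket (P.sharp Λ ξ) (P.sharp Λ η)) ζ)
        - P.halfSchouten ρ Λ ξ η (P.lie ρ Y ζ) := by
  have hN : P.sharp Λ (P.bracketOf ρ Λ ξ η) =
      L.bracket (P.sharp Λ ξ) (P.sharp Λ η) - P.sharpDefect ρ Λ ξ η := by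
    rw [sharpDefect, sub_sub_cancel]
  rw [← pairing_sharpDefect hρ hΛ, hρ.pairing_lie, hρ.pairing_lie, pairing_bracketOf hρ hΛ,
    hΛ.pairing_sharp_swap ζ, hN, L.bracket_swap Y]
  simp only [map_sub, LinearMap.sub_apply, map_neg, LinearMap.neg_apply, h1]
  abel

variable [FiniteDimensional ℝ EM] [T2Space M]

theorem schoutenSharp_eq [ContMDiffVectorBundle ∞ FB B I] (hρ : P.Invariant ρ) (hΛ : P.swap.ValuedIn 2 Λ)
    (ξ η : Cₛ^∞⟮I; FB, B⟯) :
    P.schoutenSharp ρ Λ ξ η = (2 : ℝ) • P.sharpDefect ρ Λ ξ η := by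
  have h (ζ : Cₛ^∞⟮I; FB, B⟯) :
      P.pairing ((2 : ℝ) • P.sharpDefect ρ Λ ξ η) ζ = P.schouten ρ Λ Λ ![ξ, η, ζ] := by
    rw [schouten_self, two_smul, two_smul, map_add, LinearMap.add_apply,
      pairing_sharpDefect hρ hΛ]
    rfl
  refine P.eq_of_forall_pairing_eq fun ζ => ?_
  rw [h]
  -- Twice the defect is the witness that `repr` does not take its default value.
  exact P.swap.pairing_repr (φ := fun ζ => P.schouten ρ Λ Λ ![ξ, η, ζ]) ⟨_, h⟩ ζ

theorem op_sharpDefect [ContMDiffVectorBundle ∞ FB B I] (hρ : P.Invariant ρ) (hΛ : P.swap.ValuedIn 2 Λ)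
    (h : ∀ ξ η u, ρ.op (P.schoutenSharp ρ Λ ξ η) u = 0) (ξ η : Cₛ^∞⟮I; FB, B⟯)
    (u : Cₛ^∞⟮I; FE, E⟯) : ρ.op (P.sharpDefect ρ Λ ξ η) u = 0 := by
  have h1 := h ξ η u
  rw [schoutenSharp_eq hρ hΛ, map_smul, LinearMap.smul_apply] at h1
  exact (smul_eq_zero.1 h1).resolve_left two_ne_zero

variable [ContMDiffVectorBundle ∞ FA A I]

theorem bracketOf_self (hρ : P.Invariant ρ) (ξ : Cₛ^∞⟮I; FB, B⟯) :
    P.bracketOf ρ Λ ξ ξ = 0 := by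
  have h : Λ ![ξ, ξ] = 0 := Λ.map_eq_zero_of_eq ![ξ, ξ] (i := 0) (j := 1) rfl (by simp)
  have h0 : P.dE ρ 0 = 0 := P.eq_of_forall_pairing_eq' fun X => by
    rw [hρ.pairing_dE, map_zero, map_zero]
  rw [bracketOf, sub_self, h, h0, sub_zero]

theorem bracketOf_swap (hρ : P.Invariant ρ) (hΛ : P.swap.ValuedIn 2 Λ)
    (ξ η : Cₛ^∞⟮I; FB, B⟯) : P.bracketOf ρ Λ ξ η = -P.bracketOf ρ Λ η ξ := by
  refine P.eq_of_forall_pairing_eq' fun Y => ?_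
  rw [map_neg, pairing_bracketOf hρ hΛ, pairing_bracketOf hρ hΛ, hΛ.pairing_sharp_swap η ξ,
    map_neg]
  abel

variable [ContMDiffVectorBundle ∞ FB B I]

theorem bracketOf_add_right (hρ : P.Invariant ρ) (hΛ : P.swap.ValuedIn 2 Λ)
    (ξ η ζ : Cₛ^∞⟮I; FB, B⟯) :
    P.bracketOf ρ Λ ξ (η + ζ) = P.bracketOf ρ Λ ξ η + P.bracketOf ρ Λ ξ ζ := by
  simp only [bracketOf, ← hΛ.pairing_sharp, hΛ.sharp_add, map_add, hρ.lie_add_left,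
    hρ.lie_add_right, hρ.dE_add]
  abel

theorem bracketOf_add_left (hρ : P.Invariant ρ) (hΛ : P.swap.ValuedIn 2 Λ)
    (ξ η ζ : Cₛ^∞⟮I; FB, B⟯) :
    P.bracketOf ρ Λ (ξ + η) ζ = P.bracketOf ρ Λ ξ ζ + P.bracketOf ρ Λ η ζ := by
  rw [bracketOf_swap hρ hΛ, bracketOf_add_right hρ hΛ, bracketOf_swap hρ hΛ ζ ξ,
    bracketOf_swap hρ hΛ ζ η]
  abel

theorem bracketOf_smul_right (hρ : P.Invariant ρ) (hΛ : P.swap.ValuedIn 2 Λ)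
    (f : C^∞⟮I, M; ℝ⟯) (ξ η : Cₛ^∞⟮I; FB, B⟯) :
    P.bracketOf ρ Λ ξ (f • η) =
      f • P.bracketOf ρ Λ ξ η + dirDeriv (L.anchor (P.sharp Λ ξ)) f • η := by
  refine P.eq_of_forall_pairing_eq' fun Y => ?_
  simp only [pairing_bracketOf hρ hΛ, map_add, map_smul, hΛ.sharp_smul, ρ.op_smul, ρ.smul_op,
    L.smul_bracket, map_sub, LinearMap.sub_apply, LinearMap.smul_apply, smul_sub]
  -- The derivatives of `f` along `Y`, from `d^A(fΛ(ξ, η))` and `L_{fΛη}ξ`, cancel by antisymmetry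
  -- of `Λ`.
  rw [hΛ.pairing_sharp_swap η ξ, smul_neg]
  abel

theorem bracketOf_real_smul_right (hρ : P.Invariant ρ) (hΛ : P.swap.ValuedIn 2 Λ)
    (r : ℝ) (ξ η : Cₛ^∞⟮I; FB, B⟯) :
    P.bracketOf ρ Λ ξ (r • η) = r • P.bracketOf ρ Λ ξ η := by
  let c : C^∞⟮I, M; ℝ⟯ := ⟨fun _ => r, contMDiff_const⟩
  have hd : dirDeriv (L.anchor (P.sharp Λ ξ)) c = 0 := by
    ext x
    change mvfderiv I (fun _ : M => r) x _ = 0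
    rw [mvfderiv_const]
    rfl
  have h := bracketOf_smul_right hρ hΛ c ξ η
  rw [hd, zero_smul, add_zero] at h
  exact h

theorem bracketOf_real_smul_left (hρ : P.Invariant ρ) (hΛ : P.swap.ValuedIn 2 Λ)
    (r : ℝ) (ξ η : Cₛ^∞⟮I; FB, B⟯) :
    P.bracketOf ρ Λ (r • ξ) η = r • P.bracketOf ρ Λ ξ η := by
  rw [bracketOf_swap hρ hΛ, bracketOf_real_smul_right hρ hΛ, bracketOf_swap hρ hΛ η, smul_neg,
    neg_neg]

theorem bracketOf_jacobi (hρ : P.Invariant ρ) (hΛ : P.swap.ValuedIn 2 Λ)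
    (h1 : ∀ ξ η u, ρ.op (P.schoutenSharp ρ Λ ξ η) u = 0)
    (h2 : ∀ X ξ, P.lieMulti ρ X (P.schouten ρ Λ Λ) ξ = 0) (ξ η ζ : Cₛ^∞⟮I; FB, B⟯) :
    P.bracketOf ρ Λ (P.bracketOf ρ Λ ξ η) ζ + P.bracketOf ρ Λ (P.bracketOf ρ Λ η ζ) ξ
      + P.bracketOf ρ Λ (P.bracketOf ρ Λ ζ ξ) η = 0 := by
  have h1' := op_sharpDefect hρ hΛ h1
  rw [bracketOf_swap hρ hΛ (P.bracketOf ρ Λ ξ η), bracketOf_swap hρ hΛ (P.bracketOf ρ Λ η ζ),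
    bracketOf_swap hρ hΛ (P.bracketOf ρ Λ ζ ξ)]
  refine P.eq_of_forall_pairing_eq' fun Y => ?_
  have h3 := op_halfSchouten h2 Y ξ η ζ
  -- Rotate so that each `L_Y` is in the last slot, as in the double-bracket formula; the vanishing
  -- `L_Y[Λ, Λ]` then replaces the zero on the right.
  rw [halfSchouten_cyclic (P.lie ρ Y ξ), ← halfSchouten_cyclic ζ ξ (P.lie ρ Y η)] at h3
  rw [map_add, map_add, map_neg, map_neg, map_neg, pairing_bracketOf_bracketOf hρ hΛ h1',
    pairing_bracketOf_bracketOf hρ hΛ h1', pairing_bracketOf_bracketOf hρ hΛ h1', map_zero,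
    ← sub_eq_zero.2 h3.symm, halfSchouten_eq hρ hΛ ξ η ζ]
  simp only [pairing_bracketOf hρ hΛ, hρ.pairing_lie, map_sub, map_add, ρ.flat,
    LinearMap.sub_apply, L.bracket_bracket _ _ Y]
  abel

end Bracket

/-! ### The dual Lie algebroid and the bialgebroid identities. -/

section DualAlgebroid

variable [IsManifold I ∞ M] {L : LieAlgebroid I FA A} {ρ : Representation FE E L}
  {P : DualPair I FA A FB B FE E} {Λ : Form I FB B FE E 2}

/-- Exhibits `d^B u` as the section `-Λ d^A u` of `A`, as invariance requires. -/
theorem pairing_neg_sharp_dE (hρ : P.Invariant ρ) (hΛ : P.swap.ValuedIn 2 Λ)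
    (u : Cₛ^∞⟮I; FE, E⟯) (η : Cₛ^∞⟮I; FB, B⟯) :
    P.pairing (-P.sharp Λ (P.dE ρ u)) η = ρ.op (P.sharp Λ η) u := by
  rw [map_neg, LinearMap.neg_apply, hΛ.pairing_sharp_swap, neg_neg, hρ.pairing_dE]

/-- The Lie derivative of sections of `A` with respect to `[·, ·]_Λ`. -/
theorem pairing_dual_lie (hρ : P.Invariant ρ) (hΛ : P.swap.ValuedIn 2 Λ)
    (X : Cₛ^∞⟮I; FA, A⟯) (ξ η : Cₛ^∞⟮I; FB, B⟯) :
    P.pairing (L.bracket (P.sharp Λ ξ) X + P.sharp Λ (P.lie ρ X ξ)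
        - P.sharp Λ (P.dE ρ (P.pairing X ξ))) η =
      ρ.op (P.sharp Λ ξ) (P.pairing X η) - P.pairing X (P.bracketOf ρ Λ ξ η) := by
  rw [map_sub, map_add, LinearMap.sub_apply, LinearMap.add_apply,
    hΛ.pairing_sharp_swap (P.lie ρ X ξ), hΛ.pairing_sharp_swap (P.dE ρ _), hρ.pairing_dE,
    hρ.pairing_lie, pairing_bracketOf hρ hΛ, hΛ.pairing_sharp_swap η ξ,
    L.bracket_swap X (P.sharp Λ η)]
  simp only [map_neg, LinearMap.neg_apply]
  abel

theorem coboundary_one {L : LieAlgebroid I FA A} (ρ : Representation FE E L)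
    (μ : Form I FA A FE E 1) (X : Fin 2 → Cₛ^∞⟮I; FA, A⟯) :
    coboundary ρ 1 μ X = ρ.op (X 0) (μ ![X 1]) - ρ.op (X 1) (μ ![X 0])
      - μ ![L.bracket (X 0) (X 1)] := by
  have e : X = Fin.cons (X 0) ![X 1] := by
    ext i : 1
    fin_cases i <;> rfl
  have e2 (Y Z : Cₛ^∞⟮I; FA, A⟯) : Function.update ![Y] 0 Z = ![Z] := by
    ext i : 1
    fin_cases i
    rfl
  rw [e, coboundary_cons, Fin.sum_univ_one, e2]
  simp only [coboundary]
  rw [sub_right_comm]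
  rfl

theorem lieMulti_two (X : Cₛ^∞⟮I; FA, A⟯)
    (Ξ : (Fin 2 → Cₛ^∞⟮I; FB, B⟯) → Cₛ^∞⟮I; FE, E⟯) (ξ : Fin 2 → Cₛ^∞⟮I; FB, B⟯) :
    P.lieMulti ρ X Ξ ξ = ρ.op X (Ξ ξ)
      - (Ξ ![P.lie ρ X (ξ 0), ξ 1] + Ξ ![ξ 0, P.lie ρ X (ξ 1)]) := by
  have hu (a : Cₛ^∞⟮I; FB, B⟯) : Function.update ξ 0 a = ![a, ξ 1] := by
    ext i : 1
    fin_cases i <;> rfl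
  have hv (a : Cₛ^∞⟮I; FB, B⟯) : Function.update ξ 1 a = ![ξ 0, a] := by
    ext i : 1
    fin_cases i <;> rfl
  rw [lieMulti, Fin.sum_univ_two, hu, hv]

variable [FiniteDimensional ℝ EM] [T2Space M] [ContMDiffVectorBundle ∞ FA A I]
  [ContMDiffVectorBundle ∞ FB B I]

/-- The Lie algebroid `B` with the bracket `[·, ·]_Λ` and the anchor `a ∘ Λ_♮`. -/
def dualAlgebroid [ContMDiffVectorBundle ∞ FE E I]
    (hρ : P.Invariant ρ) (hΛ : P.swap.ValuedIn 2 Λ)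
    (h1 : ∀ ξ η u, ρ.op (P.schoutenSharp ρ Λ ξ η) u = 0)
    (h2 : ∀ X ξ, P.lieMulti ρ X (P.schouten ρ Λ Λ) ξ = 0) : LieAlgebroid I FB B where
  bracket := LinearMap.mk₂ ℝ (P.bracketOf ρ Λ) (bracketOf_add_left hρ hΛ)
    (bracketOf_real_smul_left hρ hΛ) (bracketOf_add_right hρ hΛ)
    (fun r ξ η => bracketOf_real_smul_right hρ hΛ r ξ η)
  bracket_self := bracketOf_self hρ
  jacobi := bracketOf_jacobi hρ hΛ h1 h2
  anchor := L.anchor ∘ₗ sharpHom hΛ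
  anchor_bracket ξ η x := by
    have h : L.anchor (P.sharpDefect ρ Λ ξ η) = 0 :=
      ρ.anchor_eq_zero P (op_sharpDefect hρ hΛ h1 ξ η)
    rw [sharpDefect, map_sub, sub_eq_zero] at h
    refine Eq.trans ?_ (L.anchor_bracket (P.sharp Λ ξ) (P.sharp Λ η) x)
    rw [h]
    rfl
  leibniz f ξ η x := by
    refine (congrArg (fun ζ : Cₛ^∞⟮I; FB, B⟯ => ζ x) (bracketOf_smul_right hρ hΛ f ξ η)).trans ?_
    rfl

/-- The representation `ρ ∘ Λ_♮` of the Lie algebroid `B` on `E`. -/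
def dualRepresentation [ContMDiffVectorBundle ∞ FE E I]
    (hρ : P.Invariant ρ) (hΛ : P.swap.ValuedIn 2 Λ)
    (h1 : ∀ ξ η u, ρ.op (P.schoutenSharp ρ Λ ξ η) u = 0)
    (h2 : ∀ X ξ, P.lieMulti ρ X (P.schouten ρ Λ Λ) ξ = 0) :
    Representation FE E (dualAlgebroid hρ hΛ h1 h2) where
  op :=
    { toFun := fun ξ => ρ.op (P.sharp Λ ξ)
      map_add' := fun ξ η => by rw [hΛ.sharp_add, map_add]
      map_smul' := fun r ξ => by
        have h : P.sharp Λ (r • ξ) = r • P.sharp Λ ξ :=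
          hΛ.sharp_smul ⟨fun _ => r, contMDiff_const⟩ ξ
        rw [h, map_smul]
        rfl }
  smul_op f ξ u := by
    refine Eq.trans ?_ (ρ.smul_op f (P.sharp Λ ξ) u)
    rw [← hΛ.sharp_smul]
    rfl
  leibniz f ξ u x := ρ.leibniz f (P.sharp Λ ξ) u x
  flat ξ η u := by
    have h := op_sharpDefect hρ hΛ h1 ξ η u
    rw [sharpDefect, map_sub, LinearMap.sub_apply, sub_eq_zero, ρ.flat] at h
    exact h.symm

variable [ContMDiffVectorBundle ∞ FE E I] (hρ : P.Invariant ρ) (hΛ : P.swap.ValuedIn 2 Λ)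
  (h1 : ∀ ξ η u, ρ.op (P.schoutenSharp ρ Λ ξ η) u = 0)
  (h2 : ∀ X ξ, P.lieMulti ρ X (P.schouten ρ Λ Λ) ξ = 0)

theorem dualRepresentation_invariant :
    P.swap.Invariant (dualRepresentation hρ hΛ h1 h2) :=
  invariant_of_exists (fun u => ⟨_, fun η => (pairing_neg_sharp_dE hρ hΛ u η).symm⟩)
    (fun ξ X => ⟨_, fun η => (pairing_dual_lie hρ hΛ X ξ η).symm⟩)

theorem dual_dE (u : Cₛ^∞⟮I; FE, E⟯) :
    P.swap.dE (dualRepresentation hρ hΛ h1 h2) u = -P.sharp Λ (P.dE ρ u) := by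
  refine P.eq_of_forall_pairing_eq fun η => ?_
  rw [pairing_neg_sharp_dE hρ hΛ]
  exact (dualRepresentation_invariant hρ hΛ h1 h2).pairing_dE η u

theorem dual_lie (ξ : Cₛ^∞⟮I; FB, B⟯) (X : Cₛ^∞⟮I; FA, A⟯) :
    P.swap.lie (dualRepresentation hρ hΛ h1 h2) ξ X =
      L.bracket (P.sharp Λ ξ) X + P.sharp Λ (P.lie ρ X ξ)
        - P.sharp Λ (P.dE ρ (P.pairing X ξ)) := by
  refine P.eq_of_forall_pairing_eq fun η => ?_
  rw [pairing_dual_lie hρ hΛ]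
  exact (dualRepresentation_invariant hρ hΛ h1 h2).pairing_lie ξ η X

/-- The differential `d^B X` is `-L_X Λ`. -/
theorem dual_coboundary (X : Cₛ^∞⟮I; FA, A⟯) (ξ : Fin 2 → Cₛ^∞⟮I; FB, B⟯) :
    coboundary (dualRepresentation hρ hΛ h1 h2) 1 (P.swap.toForm X) ξ =
      P.pairing (P.sharp Λ (ξ 0)) (P.lie ρ X (ξ 1))
        - P.pairing (P.sharp Λ (ξ 1)) (P.lie ρ X (ξ 0))
        - ρ.op X (P.pairing (P.sharp Λ (ξ 0)) (ξ 1)) := by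
  rw [coboundary_one]
  change ρ.op (P.sharp Λ (ξ 0)) (P.pairing X (ξ 1)) - ρ.op (P.sharp Λ (ξ 1)) (P.pairing X (ξ 0))
    - P.pairing X (P.bracketOf ρ Λ (ξ 0) (ξ 1)) = _
  rw [pairing_bracketOf hρ hΛ, hρ.pairing_lie, hρ.pairing_lie,
    hΛ.pairing_sharp_swap (ξ 1) (ξ 0), L.bracket_swap X, L.bracket_swap X]
  simp only [map_neg, LinearMap.neg_apply]
  abel

/-- The triangular `E`-Lie bialgebroid defined by `Λ`. -/
theorem isELieBialgebroid_dual :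
    P.IsELieBialgebroid ρ (dualRepresentation hρ hΛ h1 h2) where
  invariant_left := hρ
  invariant_right := dualRepresentation_invariant hρ hΛ h1 h2
  d_bracket X Y ξ := by
    -- With `d^B X = -L_X Λ`, this is `L_[X,Y] Λ = L_X L_Y Λ - L_Y L_X Λ`.
    refine Eq.trans ?_ (congrArg₂ (· - ·) (lieMulti_two X _ ξ) (lieMulti_two Y _ ξ)).symm
    simp only [dual_coboundary, Matrix.cons_val_zero, Matrix.cons_val_one, hρ.lie_bracket,
      map_sub, ρ.flat]
    rw [hΛ.pairing_sharp_swap (P.lie ρ X (ξ 0)) (ξ 1),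
      hΛ.pairing_sharp_swap (P.lie ρ Y (ξ 0)) (ξ 1),
      hΛ.pairing_sharp_swap (P.lie ρ Y (ξ 0)) (P.lie ρ X (ξ 1)),
      hΛ.pairing_sharp_swap (P.lie ρ Y (ξ 1)) (P.lie ρ X (ξ 0))]
    simp only [map_neg]
    abel
  lie_d u X := by
    -- The last two terms of `L_ξ X` cancel for `ξ = d^A u`, because `L_X d^A u = d^A(ρ(X)u)`.
    rw [dual_lie, dual_dE, hρ.lie_dE, hρ.pairing_dE, map_neg, LinearMap.neg_apply, neg_neg,
      add_sub_cancel_right]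
  pairing_d u := by
    rw [dual_dE, map_neg, LinearMap.neg_apply, hΛ.pairing_sharp, neg_eq_zero]
    exact Λ.map_eq_zero_of_eq _ (i := 0) (j := 1) rfl (by simp)

end DualAlgebroid

end DualPair

end ELie

end

theorem mainTheorem11
    {EM : Type*} [NormedAddCommGroup EM] [NormedSpace ℝ EM] [FiniteDimensional ℝ EM]
    {H : Type*} [TopologicalSpace H] (I : ModelWithCorners ℝ EM H)
    {M : Type*} [TopologicalSpace M] [ChartedSpace H M] [IsManifold I ∞ M]
    [BoundarylessManifold I M] [T2Space M] [SigmaCompactSpace M]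
    {FA : Type*} [NormedAddCommGroup FA] [NormedSpace ℝ FA] [FiniteDimensional ℝ FA]
    {A : M → Type*} [TopologicalSpace (TotalSpace FA A)] [∀ x, AddCommGroup (A x)]
    [∀ x, Module ℝ (A x)] [∀ x, TopologicalSpace (A x)] [FiberBundle FA A]
    [VectorBundle ℝ FA A] [ContMDiffVectorBundle ∞ FA A I]
    {FB : Type*} [NormedAddCommGroup FB] [NormedSpace ℝ FB] [FiniteDimensional ℝ FB]
    {B : M → Type*} [TopologicalSpace (TotalSpace FB B)] [∀ x, AddCommGroup (B x)]
    [∀ x, Module ℝ (B x)] [∀ x, TopologicalSpace (B x)] [FiberBundle FB B]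
    [VectorBundle ℝ FB B] [ContMDiffVectorBundle ∞ FB B I]
    {FE : Type*} [NormedAddCommGroup FE] [NormedSpace ℝ FE] [FiniteDimensional ℝ FE]
    {E : M → Type*} [TopologicalSpace (TotalSpace FE E)] [∀ x, AddCommGroup (E x)]
    [∀ x, Module ℝ (E x)] [∀ x, TopologicalSpace (E x)] [FiberBundle FE E]
    [VectorBundle ℝ FE E] [ContMDiffVectorBundle ∞ FE E I]
    (P : ELie.DualPair I FA A FB B FE E)
    (LA : ELie.LieAlgebroid I FA A) (ρA : ELie.Representation FE E LA)
    (hρA : P.Invariant ρA)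
    (Λ : ELie.Form I FB B FE E 2) (hΛ : P.swap.ValuedIn 2 Λ)
    (h1 : ∀ (ξ η : Cₛ^∞⟮I; FB, B⟯) (u : Cₛ^∞⟮I; FE, E⟯),
      ρA.op (P.schoutenSharp ρA Λ ξ η) u = 0)
    (h2 : ∀ (X : Cₛ^∞⟮I; FA, A⟯) (ξ : Fin 3 → Cₛ^∞⟮I; FB, B⟯),
      P.lieMulti ρA X (P.schouten ρA Λ Λ) ξ = 0) :
    ∃ (LB : ELie.LieAlgebroid I FB B) (ρB : ELie.Representation FE E LB),
      (∀ ξ η : Cₛ^∞⟮I; FB, B⟯, LB.bracket ξ η = P.bracketOf ρA Λ ξ η) ∧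
      (∀ ξ : Cₛ^∞⟮I; FB, B⟯, LB.anchor ξ = LA.anchor (P.sharp Λ ξ)) ∧
      (∀ (ξ : Cₛ^∞⟮I; FB, B⟯) (u : Cₛ^∞⟮I; FE, E⟯), ρB.op ξ u = ρA.op (P.sharp Λ ξ) u) ∧
      P.swap.Invariant ρB ∧
      P.IsELieBialgebroid ρA ρB := by
  exact ⟨ELie.DualPair.dualAlgebroid hρA hΛ h1 h2, ELie.DualPair.dualRepresentation hρA hΛ h1 h2,
    fun _ _ => rfl, fun _ => rfl, fun _ _ => rfl,
    ELie.DualPair.dualRepresentation_invariant hρA hΛ h1 h2,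
    ELie.DualPair.isELieBialgebroid_dual hρA hΛ h1 h2⟩
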